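/- Let $M$ be a (Hausdorff) smooth manifold of dimension $m\ge 2$, let $P\in M$, and let $g$ be a smooth Riemannian metric defined near $P$, so that $\mathcal M=(M,g)$ is a germ of a Riemannian manifold at $P$. Let $r_P$ denote the geodesic distance to $P$ (the infimum of the $g$-lengths of $C^1$ curves from $P$), and let $\Delta_g u=-(\det g)^{-1/2}\sum_{i,j}\partial_i\big((\det g)^{1/2}g^{ij}\partial_j u\big)$ be the Laplace–Beltrami operator. The germ $(M,g)$ is called *centrally harmonic about $P$* if for every sufficiently small $\varepsilon>0$ there is a non-constant function $\check f\in C^\infty(0,\varepsilon)$ such that the radial function $f=\check f\circ r_P$ is smooth and satisfies $\Delta_g f=0$ on the punctured geodesic ball $\{0<r_P<\varepsilon\}$. Let $\psi$ be a real-valued function of one real variable which is smooth on a neighbourhood of $0$ and satisfies $\psi(0)\ne0$, and let $$g_\psi:=\psi(r_P^2)^{-2}\,g$$ be the corresponding radial conformal deformation of $g$, where $r_P$ is the geodesic distance with respect to $g$. **Theorem 1.3.** If $(M,g)$ is centrally harmonic about $P$, then $g_\psi$ is a smooth Riemannian metric near $P$ and the germ $\mathcal M_\psi=(M,g_\psi)$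 is centrally harmonic about $P$ as well. -/

import Mathlib

open Set Filter
open scoped Topology Manifold ContDiff ENNReal

namespace CentralHarmonic

noncomputable section

/-- A field of (continuous) bilinear forms on the tangent spaces of an `m`-dimensional manifold `M`.
No regularity is built in; see `IsRiemannianNear`. -/
abbrev BilinField (m : ℕ) (M : Type*) [TopologicalSpace M]
    [ChartedSpace (EuclideanSpace ℝ (Fin m)) M] :=
  (x : M) → TangentSpace (𝓡 m) x →L[ℝ] TangentSpace (𝓡 m) x →L[ℝ] ℝ

variable {m : ℕ} {M : Type*} [TopologicalSpace M] [ChartedSpace (EuclideanSpace ℝ (Fin m)) M]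

/-- `g` is a smooth Riemannian metric on some neighbourhood of `P`, that is, `(M, g)` represents
the germ at `P` of a Riemannian manifold. Nothing is asked of `g` away from `P`. -/
def IsRiemannianNear [IsManifold (𝓡 m) ∞ M] (g : BilinField m M) (P : M) : Prop :=
  ∀ᶠ x in 𝓝 P,
    (∀ v w : TangentSpace (𝓡 m) x, g x v w = g x w v) ∧
    (∀ v : TangentSpace (𝓡 m) x, v ≠ 0 → 0 < g x v v) ∧
    ContMDiffAt (𝓡 m)
      ((𝓡 m).prod 𝓘(ℝ, EuclideanSpace ℝ (Fin m) →L[ℝ] EuclideanSpace ℝ (Fin m) →L[ℝ] ℝ)) ∞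
      (fun y : M ↦ Bundle.TotalSpace.mk'
        (EuclideanSpace ℝ (Fin m) →L[ℝ] EuclideanSpace ℝ (Fin m) →L[ℝ] ℝ)
        (E := fun y : M ↦ TangentSpace (𝓡 m) y →L[ℝ] TangentSpace (𝓡 m) y →L[ℝ] ℝ) y (g y)) x

/-- The `g`-length of the curve `γ : [0, 1] → M`. -/
def curveLength (g : BilinField m M) (γ : ℝ → M) : ℝ≥0∞ :=
  ∫⁻ t in Icc (0 : ℝ) 1,
    ENNReal.ofReal (√(g (γ t) (mfderiv 𝓘(ℝ, ℝ) (𝓡 m) γ t (1 : ℝ))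
      (mfderiv 𝓘(ℝ, ℝ) (𝓡 m) γ t (1 : ℝ))))

/-- The geodesic distance from `P` to `Q`, as an extended number: the infimum of the lengths of the
`C¹` curves `γ : [0, 1] → M` from `P` to `Q`. -/
def geodesicEDist (g : BilinField m M) (P Q : M) : ℝ≥0∞ :=
  ⨅ (γ : ℝ → M) (_ : ContMDiffOn 𝓘(ℝ, ℝ) (𝓡 m) 1 γ (Icc 0 1)) (_ : γ 0 = P) (_ : γ 1 = Q),
    curveLength g γ

/-- The geodesic distance `r_P(Q)` from `P` to `Q`. (It is `0` if no curve of finite length joins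
`P` to `Q`; for a metric near `P` this does not happen for `Q` close to `P`.) -/
def geodesicDist (g : BilinField m M) (P Q : M) : ℝ :=
  (geodesicEDist g P Q).toReal

/-- The matrix `(g_{ij}(y))` of `g` in the coordinates given by the preferred chart at `P`;
`y` is a point of the target of that chart. -/
def gram (g : BilinField m M) (P : M) (y : EuclideanSpace ℝ (Fin m)) :
    Matrix (Fin m) (Fin m) ℝ :=
  Matrix.of fun i j ↦ g ((extChartAt (𝓡 m) P).symm y)
    (mfderiv (𝓡 m) (𝓡 m) (extChartAt (𝓡 m) P).symm y (EuclideanSpace.single i (1 : ℝ)))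
    (mfderiv (𝓡 m) (𝓡 m) (extChartAt (𝓡 m) P).symm y (EuclideanSpace.single j (1 : ℝ)))

/-- The `i`-th partial derivative of a function on `ℝ^m`. -/
def partialDeriv (i : Fin m) (F : EuclideanSpace ℝ (Fin m) → ℝ) (y : EuclideanSpace ℝ (Fin m)) :
    ℝ :=
  fderiv ℝ F y (EuclideanSpace.single i (1 : ℝ))

/-- The (positive) Laplace–Beltrami operator
`Δ u = - (det g)^{-1/2} ∑ᵢ ∂ᵢ ( (det g)^{1/2} ∑ⱼ g^{ij} ∂ⱼ u )`,
evaluated at a point `Q` of the domain of the preferred chart at `P` and computed in this chart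
(its value does not depend on the chart that is used). -/
def laplaceBeltrami (g : BilinField m M) (P : M) (u : M → ℝ) (Q : M) : ℝ :=
  let φ := extChartAt (𝓡 m) P;
  (-1) * (√((gram g P (φ Q)).det))⁻¹ * ∑ i : Fin m, partialDeriv i
    (fun y ↦ √((gram g P y).det) *
      ∑ j : Fin m, (gram g P y)⁻¹ i j * partialDeriv j (u ∘ φ.symm) y) (φ Q)

/-- There is a non-constant radial function `f = fr ∘ r_P`, with `fr ∈ C^∞(0, ε)`, which is
(smooth and) harmonic on the punctured ball `0 < r_P < ε`. -/
def HasRadialHarmonic (g : BilinField m M) (P : M) (ε : ℝ) : Prop :=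
  ∃ fr : ℝ → ℝ,
    ContDiffOn ℝ ∞ fr (Ioo 0 ε) ∧
    (∃ s ∈ Ioo 0 ε, ∃ t ∈ Ioo 0 ε, fr s ≠ fr t) ∧
    ∀ Q : M, 0 < geodesicDist g P Q → geodesicDist g P Q < ε →
      ContMDiffAt (𝓡 m) 𝓘(ℝ, ℝ) ∞ (fun x ↦ fr (geodesicDist g P x)) Q ∧
      laplaceBeltrami g P (fun x ↦ fr (geodesicDist g P x)) Q = 0

/-- The germ of `(M, g)` at `P` is centrally harmonic about `P`: every sufficiently small ball
`r_P < ε` (a representative of the germ, whose injectivity radius at `P` is `ε`) carries a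
non-constant radial function which is harmonic for `0 < r_P < ε`. -/
def IsCentrallyHarmonic (g : BilinField m M) (P : M) : Prop :=
  ∀ᶠ ε in 𝓝[>] (0 : ℝ), HasRadialHarmonic g P ε

/-- The radial conformal deformation `ψ(r_P²)^{-2} g`, where `r_P` is the geodesic distance from `P`
with respect to `g`. -/
def radialConformal (g : BilinField m M) (P : M) (ψ : ℝ → ℝ) : BilinField m M :=
  fun x ↦ ((ψ (geodesicDist g P x ^ 2)) ^ 2)⁻¹ • g x

end

end CentralHarmonic

/-! Put `a s = |ψ (s ^ 2)|⁻¹`, so that the new metric is `g' = a(r)² g` with `r` the `g`-distance to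
`P`. A radial conformal change keeps the radial geodesics and only reparametrises them: the
`g'`-distance is `h(r)`, where `h` is the primitive of `a` vanishing at `0`. Moreover `√det g' ·
g'⁻¹ = a(r)^(m-2) √det g · g⁻¹`. Hence if `f(r)` is `g`-harmonic and `F' = a^(2-m) f'`, the field
under the divergence in the Laplacian is the same for `(g', F(r))` as for `(g, f(r))`, and `F(r)` is
`g'`-harmonic. As a function of the new distance it is `F ∘ h⁻¹`, and it is not constant because `a
> 0`. No polar coordinates or volume density function are needed. This part is
`laplaceBeltrami_conformal`, `exists_ne_primitive_mul_deriv` and `hasRadialHarmonic_of_conformal`.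

The rest of the work shows that the distances, defined as infima over all curves in `M`, have this
form. In a chart, `r²` must be a smooth function `ρ`. The exponential map is built as the time-one
Hamiltonian flow of `p (A x p) / 2`, with `A` the inverse metric (`exists_isExponential`); this
formulation avoids connections. Its Gauss lemma and conservation of energy give the eikonal
inequality for `ρ` (`exists_isSquaredDistance`). A function that is infinitesimally 1-Lipschitz and
attained by curves is then the geodesic distance near `P`
(`IsDistanceFunction.eventually_geodesicDist_eq`). The criterion applies to `√ρ` for `g` and to
`h(√ρ)` for `g'` (`isDistanceFunction_conformal`).

Smoothness of `g'` at `P` uses that `ψ(r²) = ψ(ρ)` in the chart, and `ρ`, unlike `r`, is smooth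
there. -/

namespace CentralHarmonic

set_option maxSynthPendingDepth 3

/-! ### Smoothness of postcomposition on spaces of continuous curves -/

section Postcomposition

universe u

variable {K : Type*} [TopologicalSpace K] [CompactSpace K]
  {F G : Type u} [NormedAddCommGroup F] [NormedSpace ℝ F] [NormedAddCommGroup G] [NormedSpace ℝ G]

/-- Pointwise evaluation `(a, h) ↦ (t ↦ a t (h t))` as a continuous bilinear map. -/
noncomputable def pointwiseApply (K : Type*) [TopologicalSpace K] [CompactSpace K]
    (F G : Type u) [NormedAddCommGroup F] [NormedSpace ℝ F] [NormedAddCommGroup G]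
    [NormedSpace ℝ G] : C(K, F →L[ℝ] G) →L[ℝ] C(K, F) →L[ℝ] C(K, G) :=
  LinearMap.mkContinuous₂
    (LinearMap.mk₂ ℝ (fun (a : C(K, F →L[ℝ] G)) (h : C(K, F)) ↦
      (⟨fun t ↦ a t (h t), a.continuous.clm_apply h.continuous⟩ : C(K, G)))
      (fun a b h ↦ by ext t; simp) (fun c a h ↦ by ext t; simp)
      (fun a h k ↦ by ext t; simp) (fun c a h ↦ by ext t; simp)) 1
    (fun a h ↦ by
      rw [one_mul, ContinuousMap.norm_le _ (by positivity)]
      intro t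
      exact ((a t).le_opNorm (h t)).trans (mul_le_mul (a.norm_coe_le_norm t)
        (h.norm_coe_le_norm t) (norm_nonneg _) (by positivity)))

/-- `V'` is uniformly continuous near the compact range of `γ`, so the mean value inequality bounds
the remainder at all parameters `t` with one common `δ`. -/
lemma hasFDerivAt_postcomp (V : C(F, G)) (V' : C(F, F →L[ℝ] G))
    (hV : ∀ x, HasFDerivAt V (V' x) x) (γ : C(K, F)) :
    HasFDerivAt (fun γ : C(K, F) ↦ V.comp γ) (pointwiseApply K F G (V'.comp γ)) γ := by
  rw [hasFDerivAt_iff_isLittleO_nhds_zero, Asymptotics.isLittleO_iff]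
  intro ε hε
  have hc : IsCompact (range γ) := isCompact_range γ.continuous
  have hu := hc.uniformContinuousAt_of_continuousAt V' (fun x _ ↦ V'.continuous.continuousAt)
    (Metric.dist_mem_uniformity hε)
  obtain ⟨δ, hδ, hu⟩ := Metric.mem_uniformity_dist.1 hu
  filter_upwards [Metric.ball_mem_nhds (0 : C(K, F)) hδ] with h hh
  rw [ContinuousMap.norm_le _ (by positivity)]
  intro t
  have hht : ‖h t‖ < δ := (h.norm_coe_le_norm t).trans_lt (by simpa using hh)
  have key := (convex_ball (γ t) δ).norm_image_sub_le_of_norm_hasFDerivWithin_le' (f := V)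
    (f' := fun x ↦ V' x) (φ := V' (γ t)) (C := ε) (x := γ t) (y := γ t + h t)
    (fun x _ ↦ (hV x).hasFDerivWithinAt)
    (fun x hx ↦ by
      have := hu (a := γ t) (b := x) (by rw [dist_comm]; exact hx) (mem_range_self t)
      change dist (V' (γ t)) (V' x) < ε at this
      rw [dist_comm, dist_eq_norm] at this
      exact le_of_lt this)
    (Metric.mem_ball_self hδ) (by simpa using hht)
  simp only [add_sub_cancel_left] at key
  exact key.trans (mul_le_mul_of_nonneg_left (h.norm_coe_le_norm t) hε.le)

/-- The derivative is a bounded linear operation applied to postcomposition with `fderiv ℝ V`, which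
gives an induction on `n`. The target `G` must vary, since `fderiv ℝ V` takes values in `F →L[ℝ] G`;
this is why `F` and `G` share a universe. -/
lemma contDiff_postcomp_nat (n : ℕ) : ∀ {G : Type u} [NormedAddCommGroup G] [NormedSpace ℝ G]
    (V : C(F, G)), ContDiff ℝ ∞ V → ContDiff ℝ n (fun γ : C(K, F) ↦ V.comp γ) := by
  induction n with
  | zero =>
    intro G _ _ V hV
    exact contDiff_zero.2 V.continuous_postcomp
  | succ n ih =>
    intro G _ _ V hV
    push_cast
    rw [contDiff_succ_iff_hasFDerivAt]
    have hV' : ContDiff ℝ ∞ (fderiv ℝ V) := (contDiff_infty_iff_fderiv.1 hV).2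
    let V' : C(F, F →L[ℝ] G) := ⟨fderiv ℝ V, hV'.continuous⟩
    have hp : ContDiff ℝ n (pointwiseApply K F G) :=
      ContinuousLinearMap.contDiff (E := C(K, F →L[ℝ] G)) (F := C(K, F) →L[ℝ] C(K, G)) _
    refine ⟨fun γ ↦ pointwiseApply K F G (V'.comp γ), hp.comp (ih V' hV'), 
      fun γ ↦ hasFDerivAt_postcomp V V' ?_ γ⟩
    exact fun x ↦ (hV.differentiable (by simp) x).hasFDerivAt

/-- Postcomposition with a smooth map is smooth on the Banach space of continuous maps. -/
theorem contDiff_postcomp (V : C(F, G)) (hV : ContDiff ℝ ∞ V) :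
    ContDiff ℝ ∞ (fun γ : C(K, F) ↦ V.comp γ) :=
  contDiff_infty.2 fun n ↦ contDiff_postcomp_nat n V hV

end Postcomposition

/-! ### Inverse function theorem with smoothness on the whole target -/

section InverseFunction

variable {E F : Type*} [NormedAddCommGroup E] [NormedSpace ℝ E] [CompleteSpace E]
  [NormedAddCommGroup F] [NormedSpace ℝ F]

/-- The inverse function theorem, with a local inverse that is smooth on its whole domain. -/
theorem exists_openPartialHomeomorph_contDiffOn {f : E → F} {f' : E ≃L[ℝ] F} {a : E} {U : Set E}
    (hU : IsOpen U) (ha : a ∈ U) (hf : ContDiffOn ℝ ∞ f U)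
    (hf' : HasFDerivAt f (f' : E →L[ℝ] F) a) :
    ∃ e : OpenPartialHomeomorph E F, a ∈ e.source ∧ e.source ⊆ U ∧ (∀ x, e x = f x) ∧
      ContDiffOn ℝ ∞ e.symm e.target := by
  have hfa : ContDiffAt ℝ ∞ f a := hf.contDiffAt (hU.mem_nhds ha)
  let e₀ := hfa.toOpenPartialHomeomorph f hf' (by simp)
  have he₀ : a ∈ e₀.source := hfa.mem_toOpenPartialHomeomorph_source hf' (by simp)
  -- Restricting to points with invertible derivative, an open condition, makes the inverse smooth
  -- at every target point and not only at `f a`.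
  let S : Set E := U ∩ fderiv ℝ f ⁻¹' (range ((↑) : (E ≃L[ℝ] F) → E →L[ℝ] F))
  have hS : IsOpen S :=
    (hf.continuousOn_fderiv_of_isOpen hU (by simp)).isOpen_inter_preimage hU
      ContinuousLinearEquiv.isOpen
  have haS : a ∈ S := ⟨ha, f', hf'.fderiv.symm⟩
  refine ⟨e₀.restrOpen S hS, ⟨he₀, haS⟩, fun x hx ↦ hx.2.1, fun x ↦ rfl, ?_⟩
  intro y hy
  have hy' : (e₀.restrOpen S hS).symm y ∈ S :=
    ((e₀.restrOpen S hS).map_target hy).2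
  obtain ⟨h1, L, hL⟩ := hy'
  have h2 : ContDiffAt ℝ ∞ f ((e₀.restrOpen S hS).symm y) := hf.contDiffAt (hU.mem_nhds h1)
  refine (OpenPartialHomeomorph.contDiffAt_symm (e₀.restrOpen S hS) (f₀' := L) hy
    ?_ ?_).contDiffWithinAt
  · have := (h2.differentiableAt (by simp)).hasFDerivAt
    rw [← hL] at this
    exact this
  · exact h2

end InverseFunction

/-! ### The flow as the solution of an integral equation -/

section Flow

open MeasureTheory intervalIntegral

variable {F : Type*} [NormedAddCommGroup F]

/-- The extension of a continuous curve on `[0, 1]` to the real line by constants. -/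
noncomputable def extendCurve (γ : C(Icc (0 : ℝ) 1, F)) : ℝ → F := IccExtend zero_le_one γ

lemma continuous_extendCurve (γ : C(Icc (0 : ℝ) 1, F)) : Continuous (extendCurve γ) :=
  γ.continuous.Icc_extend'

lemma extendCurve_of_mem (γ : C(Icc (0 : ℝ) 1, F)) {t : ℝ} (ht : t ∈ Icc (0 : ℝ) 1) :
    extendCurve γ t = γ ⟨t, ht⟩ := IccExtend_of_mem _ _ ht

lemma norm_extendCurve_le (γ : C(Icc (0 : ℝ) 1, F)) (t : ℝ) : ‖extendCurve γ t‖ ≤ ‖γ‖ :=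
  γ.norm_coe_le_norm _

variable [NormedSpace ℝ F]

/-- The indefinite integral, as an operator on continuous curves on `[0, 1]`. -/
noncomputable def integralOp (F : Type*) [NormedAddCommGroup F] [NormedSpace ℝ F] :
    C(Icc (0 : ℝ) 1, F) →L[ℝ] C(Icc (0 : ℝ) 1, F) :=
  LinearMap.mkContinuous
    { toFun := fun γ ↦ ⟨fun t ↦ ∫ s in (0 : ℝ)..t, extendCurve γ s,
        (continuous_primitive
          (fun a b ↦ (continuous_extendCurve γ).intervalIntegrable a b) 0).comp
            continuous_subtype_val⟩
      map_add' := fun γ η ↦ by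
        ext t
        exact integral_add ((continuous_extendCurve γ).intervalIntegrable _ _)
          ((continuous_extendCurve η).intervalIntegrable _ _)
      map_smul' := fun c γ ↦ by
        ext t
        exact integral_smul c _ } 1
    (fun γ ↦ by
      rw [one_mul, ContinuousMap.norm_le _ (norm_nonneg _)]
      intro t
      have := norm_integral_le_of_norm_le_const (a := 0) (b := t) (C := ‖γ‖)
        (f := extendCurve γ) (fun s _ ↦ norm_extendCurve_le γ s)
      refine this.trans ?_
      rw [sub_zero, abs_of_nonneg t.2.1]
      exact mul_le_of_le_one_right (norm_nonneg _) t.2.2)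

/-- A curve satisfying an integral equation has the expected derivative. -/
lemma hasDerivAt_of_integral_eq [CompleteSpace F] (z : F) (η : C(Icc (0 : ℝ) 1, F)) (t : ℝ) :
    HasDerivAt (fun t ↦ z + ∫ s in (0 : ℝ)..t, extendCurve η s) (extendCurve η t) t :=
  ((integral_hasDerivAt_right ((continuous_extendCurve η).intervalIntegrable _ _)
    ((continuous_extendCurve η).stronglyMeasurableAtFilter _ _)
    (continuous_extendCurve η).continuousAt)).const_add z

/-- Near an equilibrium with square-zero linearisation, the time-one flow of a smooth vector field
exists and depends smoothly on the initial value, as a continuous curve. -/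
theorem exists_smooth_flow [CompleteSpace F] (V : C(F, F)) (hV : ContDiff ℝ ∞ V) {z₀ : F}
    (h₀ : V z₀ = 0)
    (hN : ∀ v, fderiv ℝ V z₀ (fderiv ℝ V z₀ v) = 0) :
    ∃ (Γ : F → C(Icc (0 : ℝ) 1, F)) (W : Set F), IsOpen W ∧ z₀ ∈ W ∧ ContDiffOn ℝ ∞ Γ W ∧
      Γ z₀ = ContinuousMap.const _ z₀ ∧
      ∀ z ∈ W, Γ z = ContinuousMap.const _ z + integralOp F (V.comp (Γ z)) := by
  have hV' : ContDiff ℝ ∞ (fderiv ℝ V) := (contDiff_infty_iff_fderiv.1 hV).2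
  let V' : C(F, F →L[ℝ] F) := ⟨fderiv ℝ V, hV'.continuous⟩
  have hd : ∀ x, HasFDerivAt V (V' x) x := fun x ↦ (hV.differentiable (by simp) x).hasFDerivAt
  let c₀ : C(Icc (0 : ℝ) 1, F) := ContinuousMap.const _ z₀
  -- `Ψ γ` is the constant curve `z` exactly when `γ` solves the integral equation with initial
  -- value `z`; a smooth local inverse of `Ψ` is thus a smooth flow.
  let Ψ : C(Icc (0 : ℝ) 1, F) → C(Icc (0 : ℝ) 1, F) := fun γ ↦ γ - integralOp F (V.comp γ)
  have hΨ : ContDiff ℝ ∞ Ψ :=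
    contDiff_id.sub ((integralOp F).contDiff.comp (contDiff_postcomp V hV))
  let B := pointwiseApply (Icc (0 : ℝ) 1) F F (V'.comp c₀)
  let N : C(Icc (0 : ℝ) 1, F) →L[ℝ] C(Icc (0 : ℝ) 1, F) := (integralOp F).comp B
  -- `B` applies the linearisation at `z₀` pointwise and this commutes with integration, so its
  -- vanishing square gives `N² = 0`. Then `id + N` inverts `id - N`, and time one is reached
  -- without any smallness assumption.
  have hBN : ∀ γ, B (N γ) = 0 := by
    intro γ
    ext t
    change fderiv ℝ V z₀ (∫ s in (0 : ℝ)..t, extendCurve (B γ) s) = 0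
    rw [← ContinuousLinearMap.intervalIntegral_comp_comm _
      ((continuous_extendCurve _).intervalIntegrable _ _)]
    have : ∀ s, fderiv ℝ V z₀ (extendCurve (B γ) s) = 0 := fun s ↦ hN _
    simp [this]
  have hNN : ∀ γ, N (N γ) = 0 := fun γ ↦ by
    change integralOp F (B (N γ)) = 0
    rw [hBN, map_zero]
  have hder : HasFDerivAt Ψ (ContinuousLinearMap.id ℝ _ - N) c₀ :=
    (hasFDerivAt_id c₀).sub
      ((integralOp F).hasFDerivAt.comp c₀ (hasFDerivAt_postcomp V V' hd c₀))
  let Leq : C(Icc (0 : ℝ) 1, F) ≃L[ℝ] C(Icc (0 : ℝ) 1, F) :=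
    ContinuousLinearEquiv.equivOfInverse (ContinuousLinearMap.id ℝ _ - N)
      (ContinuousLinearMap.id ℝ _ + N)
      (fun γ ↦ by simp [hNN]) (fun γ ↦ by simp [hNN])
  obtain ⟨e, he, -, hef, hes⟩ := exists_openPartialHomeomorph_contDiffOn (f := Ψ) (f' := Leq)
    isOpen_univ (mem_univ c₀) hΨ.contDiffOn hder
  have hc₀ : Ψ c₀ = c₀ := by
    have : V.comp c₀ = 0 := by ext t; exact h₀
    simp [Ψ, this]
  let C : F →L[ℝ] C(Icc (0 : ℝ) 1, F) := ContinuousLinearMap.const ℝ _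
  have hC : ∀ z, C z = ContinuousMap.const _ z := fun z ↦ rfl
  refine ⟨fun z ↦ e.symm (C z), C ⁻¹' e.target, e.open_target.preimage C.continuous, ?_, ?_, ?_, ?_⟩
  · change c₀ ∈ e.target
    rw [← hc₀, ← hef]
    exact e.map_source he
  · exact hes.comp C.contDiff.contDiffOn (fun _ h ↦ h)
  · change e.symm c₀ = c₀
    conv_lhs => rw [← hc₀, ← hef]
    exact e.left_inv he
  · intro z hz
    have := e.right_inv hz
    rw [hef] at this
    change e.symm (C z) - _ = C z at this
    rw [← hC, ← this]
    abel

end Flow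

/-! ### Pointwise properties of the flow and its linearisation -/

section FlowCurves

open MeasureTheory intervalIntegral

variable {F : Type*} [NormedAddCommGroup F] [NormedSpace ℝ F]

lemma eq_apply_zero_of_hasDerivWithinAt_zero {f : ℝ → F}
    (hd : ∀ t ∈ Icc (0 : ℝ) 1, HasDerivWithinAt f 0 (Icc 0 1) t) {t : ℝ} (ht : t ∈ Icc (0 : ℝ) 1) :
    f t = f 0 :=
  constant_of_has_deriv_right_zero (fun t ht ↦ (hd t ht).continuousWithinAt)
    (fun t ht ↦ (hd t (Ico_subset_Icc_self ht)).mono_of_mem_nhdsWithin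
      (Icc_mem_nhdsGE_of_mem ht)) t ht

/-- `Φ` is a smooth local flow of `V` up to time one, for initial values in the open set `W`
around the equilibrium `z₀`. -/
structure IsSmoothLocalFlow (V : F → F) (z₀ : F) (Φ : F → ℝ → F) (W : Set F) : Prop where
  isOpen : IsOpen W
  mem : z₀ ∈ W
  contDiffOn : ∀ t ∈ Icc (0 : ℝ) 1, ContDiffOn ℝ ∞ (fun z ↦ Φ z t) W
  contDiff_curve : ∀ z ∈ W, ContDiff ℝ 1 (Φ z)
  apply_zero : ∀ z ∈ W, Φ z 0 = z
  hasDerivAt : ∀ z ∈ W, ∀ t ∈ Icc (0 : ℝ) 1, HasDerivAt (Φ z) (V (Φ z t)) t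
  hasDerivWithinAt_fderiv : ∀ z ∈ W, ∀ w, ∀ t ∈ Icc (0 : ℝ) 1,
    HasDerivWithinAt (fun s ↦ fderiv ℝ (fun z ↦ Φ z s) z w)
      (fderiv ℝ V (Φ z t) (fderiv ℝ (fun z ↦ Φ z t) z w)) (Icc 0 1) t
  apply_base : ∀ t ∈ Icc (0 : ℝ) 1, Φ z₀ t = z₀
  eventually_mem : ∀ O ∈ 𝓝 z₀, ∀ᶠ z in 𝓝 z₀, ∀ t ∈ Icc (0 : ℝ) 1, Φ z t ∈ O

theorem exists_isSmoothLocalFlow [CompleteSpace F] {V : F → F} (hV : ContDiff ℝ ∞ V) {z₀ : F}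
    (h₀ : V z₀ = 0) (hN : ∀ v, fderiv ℝ V z₀ (fderiv ℝ V z₀ v) = 0) :
    ∃ Φ W, IsSmoothLocalFlow V z₀ Φ W := by
  let Vc : C(F, F) := ⟨V, hV.continuous⟩
  have hV' : ContDiff ℝ ∞ (fderiv ℝ V) := (contDiff_infty_iff_fderiv.1 hV).2
  let V' : C(F, F →L[ℝ] F) := ⟨fderiv ℝ V, hV'.continuous⟩
  have hd : ∀ x, HasFDerivAt Vc (V' x) x := fun x ↦ (hV.differentiable (by simp) x).hasFDerivAt
  obtain ⟨Γ, W, hW, hzW, hΓ, hΓ₀, hΓW⟩ := exists_smooth_flow Vc hV h₀ hN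
  -- Integrating the extended velocity defines the curve on all of `ℝ`, so that it has two-sided
  -- derivatives at the endpoints `0` and `1` too.
  let Φ : F → ℝ → F := fun z t ↦ z + ∫ s in (0 : ℝ)..t, extendCurve (Vc.comp (Γ z)) s
  have hΦΓ : ∀ z ∈ W, ∀ t (ht : t ∈ Icc (0 : ℝ) 1), Φ z t = Γ z ⟨t, ht⟩ := by
    intro z hz t ht
    conv_rhs => rw [hΓW z hz]
    rfl
  have hΦd : ∀ z t, HasDerivAt (Φ z) (extendCurve (Vc.comp (Γ z)) t) t := fun z t ↦
    hasDerivAt_of_integral_eq z _ t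
  have hΓd : ∀ z ∈ W, HasFDerivAt Γ (fderiv ℝ Γ z) z := fun z hz ↦
    ((hΓ.contDiffAt (hW.mem_nhds hz)).differentiableAt (by simp)).hasFDerivAt
  have hev : ∀ t : Icc (0 : ℝ) 1, ∀ z ∈ W, ∀ w,
      fderiv ℝ (fun z ↦ Φ z t) z w = fderiv ℝ Γ z w t := by
    intro t z hz w
    have h1 : HasFDerivAt (fun z ↦ Γ z t)
        ((ContinuousMap.evalCLM ℝ t).comp (fderiv ℝ Γ z)) z :=
      (ContinuousMap.evalCLM ℝ t : C(Icc (0 : ℝ) 1, F) →L[ℝ] F).hasFDerivAt.comp z (hΓd z hz)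
    have h2 : (fun z ↦ Φ z t) =ᶠ[𝓝 z] fun z ↦ Γ z t := by
      filter_upwards [hW.mem_nhds hz] with y hy using hΦΓ y hy t t.2
    rw [h2.fderiv_eq, h1.fderiv]
    rfl
  refine ⟨Φ, W, hW, hzW, ?_, ?_, ?_, ?_, ?_, ?_, ?_⟩
  · intro t ht
    refine ContDiffOn.congr (f := fun z ↦ Γ z ⟨t, ht⟩) ?_ fun z hz ↦ hΦΓ z hz t ht
    exact (ContinuousMap.evalCLM ℝ (⟨t, ht⟩ : Icc (0 : ℝ) 1) :
      C(Icc (0 : ℝ) 1, F) →L[ℝ] F).contDiff.comp_contDiffOn hΓ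
  · intro z hz
    rw [contDiff_one_iff_deriv]
    refine ⟨fun t ↦ (hΦd z t).differentiableAt, ?_⟩
    rw [funext fun t ↦ (hΦd z t).deriv]
    exact continuous_extendCurve _
  · intro z _
    simp [Φ]
  · intro z hz t ht
    have := hΦd z t
    rw [extendCurve_of_mem _ ht] at this
    rw [hΦΓ z hz t ht]
    exact this
  · intro z hz w t ht
    let δ := fderiv ℝ Γ z w
    let η := pointwiseApply (Icc (0 : ℝ) 1) F F (V'.comp (Γ z)) δ
    have hδ : δ = ContinuousMap.const _ w + integralOp F η := by
      -- Differentiating the fixed-point identity for `Γ` in the initial value yields the linearised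
      -- integral equation.
      let C : F →L[ℝ] C(Icc (0 : ℝ) 1, F) := ContinuousLinearMap.const ℝ _
      have h1 := C.hasFDerivAt (x := z) |>.add ((integralOp F).hasFDerivAt.comp z
        ((hasFDerivAt_postcomp Vc V' hd (Γ z)).comp z (hΓd z hz)))
      have h2 : Γ =ᶠ[𝓝 z] (C + integralOp F ∘ (fun γ ↦ Vc.comp γ) ∘ Γ) := by
        filter_upwards [hW.mem_nhds hz] with y hy using hΓW y hy
      exact DFunLike.congr_fun ((hΓd z hz).unique (h1.congr_of_eventuallyEq h2)) w
    have hδt : ∀ s (hs : s ∈ Icc (0 : ℝ) 1),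
        fderiv ℝ (fun z ↦ Φ z s) z w = w + ∫ r in (0 : ℝ)..s, extendCurve η r := by
      intro s hs
      rw [hev ⟨s, hs⟩ z hz w]
      change δ ⟨s, hs⟩ = _
      rw [hδ]
      rfl
    have h3 := (hasDerivAt_of_integral_eq w η t).hasDerivWithinAt (s := Icc 0 1)
    rw [extendCurve_of_mem _ ht] at h3
    have h4 : η ⟨t, ht⟩ = fderiv ℝ V (Φ z t) (fderiv ℝ (fun z ↦ Φ z t) z w) := by
      rw [hev ⟨t, ht⟩ z hz w, hΦΓ z hz t ht]
      rfl
    rw [h4] at h3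
    exact h3.congr hδt (hδt t ht)
  · intro t ht
    rw [hΦΓ z₀ hzW t ht, hΓ₀]
    rfl
  · intro O hO
    obtain ⟨r, hr, hrO⟩ := Metric.mem_nhds_iff.1 hO
    have hc : ContinuousAt Γ z₀ := (hΓ.continuousOn.continuousAt (hW.mem_nhds hzW))
    filter_upwards [hc (Metric.ball_mem_nhds _ hr), hW.mem_nhds hzW] with z hz hzW' t ht
    rw [hΦΓ z hzW' t ht]
    apply hrO
    rw [mem_preimage, hΓ₀, Metric.mem_ball] at hz
    exact (ContinuousMap.dist_apply_le_dist ⟨t, ht⟩).trans_lt hz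

end FlowCurves

/-! ### Hamiltonian flow, exponential map and Gauss lemma -/

section Hamiltonian

universe u

variable {E : Type u} [NormedAddCommGroup E] [NormedSpace ℝ E]

/-- The Hamiltonian vector field of `H (x, p) = p (A x p) / 2` on `E × E*`. -/
noncomputable def hamiltonianField (A : E → (E →L[ℝ] ℝ) →L[ℝ] E) (z : E × (E →L[ℝ] ℝ)) :
    E × (E →L[ℝ] ℝ) :=
  (A z.1 z.2, -(1 / 2 : ℝ) • z.2.comp ((fderiv ℝ A z.1).flip z.2))

variable {A : E → (E →L[ℝ] ℝ) →L[ℝ] E}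

lemma contDiff_flip_fderiv_apply (hA : ContDiff ℝ ∞ A) :
    ContDiff ℝ ∞ (fun z : E × (E →L[ℝ] ℝ) ↦ (fderiv ℝ A z.1).flip z.2) := by
  have hA' : ContDiff ℝ ∞ (fderiv ℝ A) := (contDiff_infty_iff_fderiv.1 hA).2
  have h : ContDiff ℝ ∞ (fun x ↦ (fderiv ℝ A x).flip) :=
    (ContinuousLinearMap.flipₗᵢ ℝ E (E →L[ℝ] ℝ) E).contDiff.comp hA'
  exact (h.comp contDiff_fst).clm_apply contDiff_snd

lemma contDiff_hamiltonianField (hA : ContDiff ℝ ∞ A) : ContDiff ℝ ∞ (hamiltonianField A) :=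
  ((hA.comp contDiff_fst).clm_apply contDiff_snd).prodMk
    ((contDiff_snd.clm_comp (contDiff_flip_fderiv_apply hA)).const_smul _)

lemma hasFDerivAt_apply_momentum (hA : ContDiff ℝ ∞ A) (z : E × (E →L[ℝ] ℝ)) :
    HasFDerivAt (fun z : E × (E →L[ℝ] ℝ) ↦ A z.1 z.2)
      ((A z.1).comp (ContinuousLinearMap.snd ℝ _ _) +
        ((fderiv ℝ A z.1).flip z.2).comp (ContinuousLinearMap.fst ℝ _ _)) z := by
  have h1 : HasFDerivAt (fun z : E × (E →L[ℝ] ℝ) ↦ A z.1)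
      ((fderiv ℝ A z.1).comp (ContinuousLinearMap.fst ℝ _ _)) z :=
    (hA.differentiable (by simp) z.1).hasFDerivAt.comp z hasFDerivAt_fst
  exact (h1.clm_apply hasFDerivAt_snd).congr_fderiv (by ext w <;> simp)

lemma fderiv_hamiltonianField_fst (hA : ContDiff ℝ ∞ A) (z w : E × (E →L[ℝ] ℝ)) :
    (fderiv ℝ (hamiltonianField A) z w).1 = A z.1 w.2 + fderiv ℝ A z.1 w.1 z.2 := by
  have h2 := (((contDiff_hamiltonianField hA).differentiable (by simp) z).hasFDerivAt).fst
  have := h2.unique (hasFDerivAt_apply_momentum hA z)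
  have := DFunLike.congr_fun this w
  exact this

/-- The momentum component is quadratic in the momentum. With `fderiv_hamiltonianField_fst`, the
linearisation at `(x₀, 0)` is `(ξ, π) ↦ (A x₀ π, 0)`, whose square is zero as
`exists_isSmoothLocalFlow` requires. -/
lemma fderiv_hamiltonianField_snd_zero (hA : ContDiff ℝ ∞ A) (x₀ : E) (w : E × (E →L[ℝ] ℝ)) :
    (fderiv ℝ (hamiltonianField A) (x₀, 0) w).2 = 0 := by
  have h2 := (((contDiff_hamiltonianField hA).differentiable (by simp) (x₀, 0)).hasFDerivAt).snd
  have h3 : HasFDerivAt (fun z : E × (E →L[ℝ] ℝ) ↦ (fderiv ℝ A z.1).flip z.2) _ (x₀, 0) :=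
    ((contDiff_flip_fderiv_apply hA).differentiable (by simp) (x₀, 0)).hasFDerivAt
  have h4 := (HasFDerivAt.clm_comp (hasFDerivAt_snd (p := ((x₀, 0) : E × (E →L[ℝ] ℝ)))) h3).const_smul
    (-(1 / 2 : ℝ))
  have := DFunLike.congr_fun (h2.unique h4) w
  refine Eq.trans this ?_
  simp

/-- The energy is constant along integral curves of the Hamiltonian vector field. -/
lemma hasDerivAt_energy (hA : ContDiff ℝ ∞ A)
    (hsymm : ∀ x, ∀ p q : E →L[ℝ] ℝ, p (A x q) = q (A x p)) {c : ℝ → E × (E →L[ℝ] ℝ)} {t : ℝ}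
    (hc : HasDerivAt c (hamiltonianField A (c t)) t) :
    HasDerivAt (fun t ↦ (c t).2 (A (c t).1 (c t).2)) 0 t := by
  have h1 : HasDerivAt (fun t ↦ (c t).1) (hamiltonianField A (c t)).1 t := by
    simpa using hc.hasFDerivAt.fst.hasDerivAt
  have h2 : HasDerivAt (fun t ↦ (c t).2) (hamiltonianField A (c t)).2 t := by
    simpa using hc.hasFDerivAt.snd.hasDerivAt
  have h3 : HasDerivAt (fun t ↦ A (c t).1) (fderiv ℝ A (c t).1 (hamiltonianField A (c t)).1) t :=
    (hA.differentiable (by simp) (c t).1).hasFDerivAt.comp_hasDerivAt t h1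
  refine (h2.clm_apply (h3.clm_apply h2)).congr_deriv ?_
  rw [map_add, hsymm (c t).1 (c t).2]
  simp only [hamiltonianField, smul_apply, ContinuousLinearMap.comp_apply,
    ContinuousLinearMap.flip_apply, smul_eq_mul]
  ring

/-- Existence and first properties of the exponential map of the Hamiltonian `p (A x p) / 2`, in
terms of the initial momentum `p`: `X p` is the geodesic and `Y p` its momentum. -/
structure IsExponential (A : E → (E →L[ℝ] ℝ) →L[ℝ] E) (x₀ : E) (X : (E →L[ℝ] ℝ) → ℝ → E)
    (Y : (E →L[ℝ] ℝ) → ℝ → (E →L[ℝ] ℝ)) (W : Set (E →L[ℝ] ℝ)) : Prop where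
  isOpen : IsOpen W
  mem : 0 ∈ W
  contDiffOn : ContDiffOn ℝ ∞ (fun p ↦ X p 1) W
  hasFDerivAt_zero : HasFDerivAt (fun p ↦ X p 1) (A x₀) 0
  contDiff_curve : ∀ p ∈ W, ContDiff ℝ 1 (X p)
  apply_zero : ∀ p ∈ W, X p 0 = x₀
  apply_base : X 0 1 = x₀
  hasDerivAt : ∀ p ∈ W, ∀ t ∈ Icc (0 : ℝ) 1, HasDerivAt (X p) (A (X p t) (Y p t)) t
  energy : ∀ p ∈ W, ∀ t ∈ Icc (0 : ℝ) 1, Y p t (A (X p t) (Y p t)) = p (A x₀ p)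
  gauss : ∀ p ∈ W, ∀ w, Y p 1 (fderiv ℝ (fun p ↦ X p 1) p w) = p (A x₀ w)
  eventually_mem : ∀ O ∈ 𝓝 x₀, ∀ᶠ p in 𝓝 0, ∀ t ∈ Icc (0 : ℝ) 1, X p t ∈ O

-- Gauss lemma: for a variation `(δX, δY)` of the flow, the time derivative of `Y (δX)` is the
-- variation of the Hamiltonian `p (A x p) / 2`. By conservation of energy this does not depend on
-- time, and for a variation of the initial momentum by `w` it equals `p (A x₀ w)`. Since `δX = 0`
-- at time `0`, integration up to time `1` gives `gauss`. At `p = 0` the linearised flow is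
-- explicit, `δY = w` and `δX = t • A x₀ w`, which gives the derivative of the exponential map.
set_option maxHeartbeats 1000000 in
theorem exists_isExponential [CompleteSpace E] (hA : ContDiff ℝ ∞ A)
    (hsymm : ∀ x, ∀ p q : E →L[ℝ] ℝ, p (A x q) = q (A x p)) (x₀ : E) :
    ∃ X Y W, IsExponential A x₀ X Y W := by
  have hV := contDiff_hamiltonianField hA
  obtain ⟨Φ, W, h⟩ := exists_isSmoothLocalFlow hV (z₀ := (x₀, 0))
    (by simp [hamiltonianField]) (by
      intro v
      have h2 : (fderiv ℝ (hamiltonianField A) (x₀, 0) v).2 = 0 :=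
        fderiv_hamiltonianField_snd_zero hA x₀ v
      refine Prod.ext ?_ (fderiv_hamiltonianField_snd_zero hA x₀ _)
      rw [fderiv_hamiltonianField_fst hA, h2]
      simp)
  -- the energy is conserved along the flow
  have hener : ∀ z ∈ W, ∀ t ∈ Icc (0 : ℝ) 1,
      (Φ z t).2 (A (Φ z t).1 (Φ z t).2) = z.2 (A z.1 z.2) := by
    intro z hz
    have hd : ∀ t ∈ Icc (0 : ℝ) 1, HasDerivAt (fun t ↦ (Φ z t).2 (A (Φ z t).1 (Φ z t).2)) 0 t :=
      fun t ht ↦ hasDerivAt_energy hA hsymm (h.hasDerivAt z hz t ht)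
    have hcont : ContinuousOn (fun t ↦ (Φ z t).2 (A (Φ z t).1 (Φ z t).2)) (Icc 0 1) :=
      fun t ht ↦ (hd t ht).continuousAt.continuousWithinAt
    have := constant_of_has_deriv_right_zero hcont
      (fun t ht ↦ (hd t (Ico_subset_Icc_self ht)).hasDerivWithinAt)
    intro t ht
    rw [this t ht, h.apply_zero z hz]
  have hΦd : ∀ t ∈ Icc (0 : ℝ) 1, ∀ z ∈ W,
      HasFDerivAt (fun z ↦ Φ z t) (fderiv ℝ (fun z ↦ Φ z t) z) z := fun t ht z hz ↦
    (((h.contDiffOn t ht).contDiffAt (h.isOpen.mem_nhds hz)).differentiableAt (by simp)).hasFDerivAt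
  have hΦ0 : ∀ z ∈ W, ∀ w, fderiv ℝ (fun z ↦ Φ z 0) z w = w := by
    intro z hz w
    have : (fun z ↦ Φ z 0) =ᶠ[𝓝 z] id := by
      filter_upwards [h.isOpen.mem_nhds hz] with y hy using h.apply_zero y hy
    rw [this.fderiv_eq]
    simp
  -- the derivative of the energy in the initial values
  have hHd : ∀ z : E × (E →L[ℝ] ℝ), ∃ L : (E × (E →L[ℝ] ℝ)) →L[ℝ] ℝ,
      HasFDerivAt (fun z : E × (E →L[ℝ] ℝ) ↦ z.2 (A z.1 z.2)) L z ∧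
      ∀ w, L w = 2 * z.2 (A z.1 w.2) + z.2 (fderiv ℝ A z.1 w.1 z.2) := by
    intro z
    refine ⟨_, HasFDerivAt.clm_apply (hasFDerivAt_snd (p := z)) (hasFDerivAt_apply_momentum hA z), ?_⟩
    intro w
    simp only [add_apply, ContinuousLinearMap.coe_comp, Function.comp_apply,
      ContinuousLinearMap.flip_apply, ContinuousLinearMap.coe_fst',
      ContinuousLinearMap.coe_snd', map_add]
    rw [hsymm z.1 w.2]
    ring
  have hvar : ∀ z ∈ W, ∀ w, ∀ t ∈ Icc (0 : ℝ) 1,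
      2 * (Φ z t).2 (A (Φ z t).1 (fderiv ℝ (fun z ↦ Φ z t) z w).2) +
        (Φ z t).2 (fderiv ℝ A (Φ z t).1 (fderiv ℝ (fun z ↦ Φ z t) z w).1 (Φ z t).2) =
      2 * z.2 (A z.1 w.2) + z.2 (fderiv ℝ A z.1 w.1 z.2) := by
    intro z hz w t ht
    obtain ⟨L, hL, hL'⟩ := hHd (Φ z t)
    obtain ⟨L₀, hL₀, hL₀'⟩ := hHd z
    rw [← hL', ← hL₀']
    have h1 := hL.comp z (hΦd t ht z hz)
    have h2 : ((fun z : E × (E →L[ℝ] ℝ) ↦ z.2 (A z.1 z.2)) ∘ fun z ↦ Φ z t) =ᶠ[𝓝 z]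
        (fun z : E × (E →L[ℝ] ℝ) ↦ z.2 (A z.1 z.2)) := by
      filter_upwards [h.isOpen.mem_nhds hz] with y hy using hener y hy t ht
    have h3 := h1.unique (hL₀.congr_of_eventuallyEq h2)
    exact DFunLike.congr_fun h3 w
  -- the Gauss lemma
  have hgauss : ∀ z ∈ W, ∀ w : E →L[ℝ] ℝ, (Φ z 1).2 (fderiv ℝ (fun z ↦ Φ z 1) z (0, w)).1 =
      z.2 (A z.1 w) := by
    intro z hz w
    let f : ℝ → ℝ := fun t ↦ (Φ z t).2 (fderiv ℝ (fun z ↦ Φ z t) z (0, w)).1 - t * z.2 (A z.1 w)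
    have hd : ∀ t ∈ Icc (0 : ℝ) 1, HasDerivWithinAt f 0 (Icc 0 1) t := by
      intro t ht
      have h1 := (h.hasDerivAt z hz t ht).hasFDerivAt.snd.hasDerivAt.hasDerivWithinAt (s := Icc 0 1)
      have h2 := (h.hasDerivWithinAt_fderiv z hz (0, w) t ht).hasFDerivWithinAt.fst.hasDerivWithinAt
      have h3 := (h1.clm_apply h2).sub
        ((hasDerivAt_id t).mul_const (z.2 (A z.1 w))).hasDerivWithinAt
      refine h3.congr_deriv ?_
      have h4 := hvar z hz (0, w) t ht
      simp only [ContinuousLinearMap.coe_comp, Function.comp_apply,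
        ContinuousLinearMap.toSpanSingleton_apply, ContinuousLinearMap.coe_fst',
        ContinuousLinearMap.coe_snd', one_smul, fderiv_hamiltonianField_fst hA]
      simp [hamiltonianField] at h4 ⊢
      linarith
    have := eq_apply_zero_of_hasDerivWithinAt_zero hd (right_mem_Icc.2 zero_le_one)
    simp [f, hΦ0 z hz] at this
    linarith
  let i : (E →L[ℝ] ℝ) → E × (E →L[ℝ] ℝ) := fun p ↦ (x₀, p)
  have hi : ContDiff ℝ ∞ i := contDiff_const.prodMk contDiff_id
  have hid : ∀ p, HasFDerivAt i (ContinuousLinearMap.inr ℝ E (E →L[ℝ] ℝ)) p := fun p ↦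
    (hasFDerivAt_const x₀ p).prodMk (hasFDerivAt_id p)
  have h1I : (1 : ℝ) ∈ Icc (0 : ℝ) 1 := right_mem_Icc.2 zero_le_one
  have hexpd : ∀ p, i p ∈ W → HasFDerivAt (fun p ↦ (Φ (i p) 1).1)
      ((ContinuousLinearMap.fst ℝ E (E →L[ℝ] ℝ)).comp
        ((fderiv ℝ (fun z ↦ Φ z 1) (i p)).comp (ContinuousLinearMap.inr ℝ E (E →L[ℝ] ℝ)))) p :=
    fun p hp ↦ ((hΦd 1 h1I _ hp).comp p (hid p)).fst
  refine ⟨fun p t ↦ (Φ (i p) t).1, fun p t ↦ (Φ (i p) t).2, i ⁻¹' W,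
    h.isOpen.preimage hi.continuous, h.mem, ?_, ?_, ?_, ?_, ?_, ?_, ?_, ?_, ?_⟩
  · exact contDiff_fst.comp_contDiffOn ((h.contDiffOn 1 h1I).comp hi.contDiffOn fun _ hp ↦ hp)
  · refine (hexpd 0 h.mem).congr_fderiv ?_
    ext w
    -- the linearised flow at the equilibrium
    have hb : ∀ t ∈ Icc (0 : ℝ) 1, Φ (i 0) t = (x₀, 0) := fun t ht ↦ h.apply_base t ht
    let D : ℝ → E × (E →L[ℝ] ℝ) := fun t ↦ fderiv ℝ (fun z ↦ Φ z t) (i 0) (0, w)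
    have hD0 : D 0 = (0, w) := hΦ0 (i 0) h.mem (0, w)
    have hD : ∀ t ∈ Icc (0 : ℝ) 1,
        HasDerivWithinAt D (fderiv ℝ (hamiltonianField A) (x₀, 0) (D t)) (Icc 0 1) t := by
      intro t ht
      have := h.hasDerivWithinAt_fderiv (i 0) h.mem (0, w) t ht
      rwa [hb t ht] at this
    have hD2 : ∀ t ∈ Icc (0 : ℝ) 1, (D t).2 = w := by
      intro t ht
      have hd : ∀ t ∈ Icc (0 : ℝ) 1, HasDerivWithinAt (fun t ↦ (D t).2) 0 (Icc 0 1) t := by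
        intro t ht
        have := (hD t ht).hasFDerivWithinAt.snd.hasDerivWithinAt
        simpa [fderiv_hamiltonianField_snd_zero hA] using this
      have := eq_apply_zero_of_hasDerivWithinAt_zero hd ht
      rwa [hD0] at this
    have hd : ∀ t ∈ Icc (0 : ℝ) 1, HasDerivWithinAt (fun t ↦ (D t).1 - t • A x₀ w) 0 (Icc 0 1) t := by
      intro t ht
      have := ((hD t ht).hasFDerivWithinAt.fst.hasDerivWithinAt).sub
        ((hasDerivAt_id t).smul_const (A x₀ w)).hasDerivWithinAt
      refine this.congr_deriv ?_
      simp [fderiv_hamiltonianField_fst hA, hD2 t ht]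
    have := eq_apply_zero_of_hasDerivWithinAt_zero hd h1I
    rw [hD0, one_smul, zero_smul, sub_zero, sub_eq_zero] at this
    exact this
  · exact fun p hp ↦ contDiff_fst.comp (h.contDiff_curve _ hp)
  · intro p hp
    simp [h.apply_zero _ hp, i]
  · change (Φ (x₀, 0) 1).1 = x₀
    rw [h.apply_base 1 h1I]
  · intro p hp t ht
    have := (h.hasDerivAt _ hp t ht).hasFDerivAt.fst.hasDerivAt
    simpa [hamiltonianField] using this
  · exact fun p hp t ht ↦ hener (i p) hp t ht
  · intro p hp w
    rw [(hexpd p hp).fderiv]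
    exact hgauss (i p) hp w
  · intro O hO
    have h1 := h.eventually_mem (Prod.fst ⁻¹' O) (continuous_fst.continuousAt.preimage_mem_nhds hO)
    exact (hi.continuous.continuousAt (x := 0)).eventually h1

end Hamiltonian

/-! ### The squared distance and the eikonal inequality -/

section Eikonal

universe u

variable {E : Type u} [NormedAddCommGroup E] [NormedSpace ℝ E]

/-- Cauchy–Schwarz, from nonnegativity of the form at `B v v • w - B v w • v`. -/
lemma sq_apply_le_of_symm_of_nonneg {B : E →L[ℝ] E →L[ℝ] ℝ} (hs : ∀ v w, B v w = B w v)
    (hp : ∀ v, v ≠ 0 → 0 < B v v) (v w : E) : (B v w) ^ 2 ≤ B v v * B w w := by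
  rcases eq_or_ne v 0 with rfl | hv
  · simp
  have ha := hp v hv
  have h0 : 0 ≤ B (B v v • w - B v w • v) (B v v • w - B v w • v) := by
    rcases eq_or_ne (B v v • w - B v w • v) 0 with h | h
    · simp [h]
    · exact (hp _ h).le
  simp only [map_sub, map_smul, sub_apply, smul_apply, smul_eq_mul, hs w v] at h0
  have h1 : 0 ≤ B v v * (B v v * B w w - B v w ^ 2) := by linarith
  linarith [nonneg_of_mul_nonneg_right h1 ha]

/-- A positive definite form on a finite-dimensional space identifies it with its dual. -/
lemma exists_equiv_dual_of_posDef [FiniteDimensional ℝ E] {B : E →L[ℝ] E →L[ℝ] ℝ}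
    (hp : ∀ v, v ≠ 0 → 0 < B v v) :
    ∃ e : E ≃L[ℝ] (E →L[ℝ] ℝ), (e : E →L[ℝ] (E →L[ℝ] ℝ)) = B := by
  have hinj : Function.Injective (B : E →ₗ[ℝ] (E →L[ℝ] ℝ)) := by
    rw [← LinearMap.ker_eq_bot, LinearMap.ker_eq_bot']
    intro v hv
    by_contra h
    have := hp v h
    rw [show B v = 0 from hv] at this
    simp at this
  have hdim : Module.finrank ℝ E = Module.finrank ℝ (E →L[ℝ] ℝ) := by
    rw [← (LinearMap.toContinuousLinearMap (𝕜 := ℝ) (E := E) (F' := ℝ)).finrank_eq]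
    exact (Subspace.dual_finrank_eq (K := ℝ) (V := E)).symm
  refine ⟨(LinearEquiv.ofInjectiveOfFinrankEq (B : E →ₗ[ℝ] (E →L[ℝ] ℝ)) hinj
    hdim).toContinuousLinearEquiv, ?_⟩
  ext v w
  rfl

/-- A globally smooth field of symmetric forms on the dual which inverts a given metric near a
point. -/
lemma exists_contDiff_inverse_metric [FiniteDimensional ℝ E] {G : E → E →L[ℝ] E →L[ℝ] ℝ}
    {U₀ : Set E} (hU₀ : IsOpen U₀) {x₀ : E} (hx₀ : x₀ ∈ U₀) (hG : ContDiffOn ℝ ∞ G U₀)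
    (hs : ∀ x ∈ U₀, ∀ v w, G x v w = G x w v) (hp : ∀ x ∈ U₀, ∀ v, v ≠ 0 → 0 < G x v v) :
    ∃ (A : E → (E →L[ℝ] ℝ) →L[ℝ] E) (U₁ : Set E), IsOpen U₁ ∧ x₀ ∈ U₁ ∧ U₁ ⊆ U₀ ∧
      ContDiff ℝ ∞ A ∧ (∀ x, ∀ p q : E →L[ℝ] ℝ, p (A x q) = q (A x p)) ∧
      (∀ x ∈ U₁, ∀ p, G x (A x p) = p) := by
  have hinv : ∀ x ∈ U₀, ∀ p, G x (ContinuousLinearMap.inverse (G x) p) = p := by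
    intro x hx p
    obtain ⟨e, he⟩ := exists_equiv_dual_of_posDef (hp x hx)
    rw [← he, ContinuousLinearMap.inverse_equiv]
    exact e.apply_symm_apply p
  obtain ⟨r, hr, hrU⟩ := Metric.isOpen_iff.1 hU₀ x₀ hx₀
  -- The flow construction needs a field defined and smooth everywhere. The cutoff supplies this,
  -- keeps the symmetry, and leaves the inverse metric unchanged on the ball of radius `r / 4`.
  let χ : ContDiffBump x₀ := ⟨r / 4, r / 2, by linarith, by linarith⟩
  have hχU : tsupport χ ⊆ U₀ := by
    rw [χ.tsupport_eq]
    exact (Metric.closedBall_subset_ball (by change r / 2 < r; linarith)).trans hrU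
  refine ⟨fun x ↦ χ x • ContinuousLinearMap.inverse (G x), Metric.ball x₀ (r / 4),
    Metric.isOpen_ball, Metric.mem_ball_self (by linarith),
    (Metric.ball_subset_ball (by linarith)).trans hrU, ?_, ?_, ?_⟩
  · rw [contDiff_iff_contDiffAt]
    intro x
    by_cases hx : x ∈ tsupport χ
    · have hxU := hχU hx
      obtain ⟨e, he⟩ := exists_equiv_dual_of_posDef (hp x hxU)
      have h1 : ContDiffAt ℝ ∞ ContinuousLinearMap.inverse (G x) := by
        rw [← he]
        exact contDiffAt_map_inverse e
      exact χ.contDiff.contDiffAt.smul (h1.comp x (hG.contDiffAt (hU₀.mem_nhds hxU)))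
    · have h0 : (fun x ↦ χ x • ContinuousLinearMap.inverse (G x)) =ᶠ[𝓝 x] fun _ ↦ 0 := by
        filter_upwards [notMem_tsupport_iff_eventuallyEq.1 hx] with y hy
        simp [hy]
      exact contDiffAt_const.congr_of_eventuallyEq h0
  · intro x p q
    by_cases hx : x ∈ U₀
    · have h1 : p (ContinuousLinearMap.inverse (G x) q) = q (ContinuousLinearMap.inverse (G x) p) := by
        conv_lhs => rw [← hinv x hx p]
        conv_rhs => rw [← hinv x hx q]
        exact hs x hx _ _
      simp [h1]
    · have : χ x = 0 := image_eq_zero_of_notMem_tsupport fun h ↦ hx (hχU h)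
      simp [this]
  · intro x hx p
    have : χ x = 1 := χ.one_of_mem_closedBall (Metric.ball_subset_closedBall hx)
    simp only [this, one_smul]
    exact hinv x (hrU (Metric.ball_subset_ball (by linarith) hx)) p

/-- `ρ` is the squared distance to `x₀` of the metric `G` on the neighbourhood `U` of `x₀`,
described by the eikonal inequality and the existence of geodesics. -/
structure IsSquaredDistance (G : E → E →L[ℝ] E →L[ℝ] ℝ) (x₀ : E) (ρ : E → ℝ) (U : Set E) :
    Prop where
  isOpen : IsOpen U
  mem : x₀ ∈ U
  contDiffOn : ContDiffOn ℝ ∞ ρ U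
  apply_base : ρ x₀ = 0
  pos : ∀ x ∈ U, x ≠ x₀ → 0 < ρ x
  eikonal : ∀ x ∈ U, ∀ v, (fderiv ℝ ρ x v) ^ 2 ≤ 4 * ρ x * G x v v
  geodesic : ∀ O ∈ 𝓝 x₀, ∀ᶠ x in 𝓝 x₀, ∃ c : ℝ → E, ContDiff ℝ 1 c ∧ c 0 = x₀ ∧ c 1 = x ∧
    ∀ t ∈ Icc (0 : ℝ) 1, c t ∈ O ∧ G (c t) (deriv c t) (deriv c t) = ρ x

/-- Take `ρ x = p (A x₀ p)` with `p` the initial momentum of the geodesic reaching `x` at time one.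
The Gauss lemma says that `dρ` is twice the terminal momentum, conservation of energy says that this
momentum has squared norm `ρ x`, and Cauchy–Schwarz then gives the eikonal inequality. -/
theorem exists_isSquaredDistance [FiniteDimensional ℝ E] {G : E → E →L[ℝ] E →L[ℝ] ℝ}
    {U₀ : Set E} (hU₀ : IsOpen U₀) {x₀ : E} (hx₀ : x₀ ∈ U₀) (hG : ContDiffOn ℝ ∞ G U₀)
    (hs : ∀ x ∈ U₀, ∀ v w, G x v w = G x w v) (hp : ∀ x ∈ U₀, ∀ v, v ≠ 0 → 0 < G x v v) :
    ∃ ρ U, U ⊆ U₀ ∧ IsSquaredDistance G x₀ ρ U := by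
  have : CompleteSpace E := FiniteDimensional.complete ℝ E
  obtain ⟨A, U₁, hU₁, hx₁, hU₁₀, hA, hAs, hGA⟩ := exists_contDiff_inverse_metric hU₀ hx₀ hG hs hp
  obtain ⟨X, Y, W, h⟩ := exists_isExponential hA hAs x₀
  have hpA : ∀ x ∈ U₁, ∀ p, p (A x p) = G x (A x p) (A x p) := fun x hx p ↦ by rw [hGA x hx]
  obtain ⟨e₀, he₀⟩ := exists_equiv_dual_of_posDef (hp x₀ hx₀)
  have hAe : (e₀.symm : (E →L[ℝ] ℝ) →L[ℝ] E) = A x₀ := by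
    ext p
    apply e₀.injective
    have h1 : e₀ (A x₀ p) = G x₀ (A x₀ p) := DFunLike.congr_fun he₀ _
    rw [h1, hGA x₀ hx₁]
    exact e₀.apply_symm_apply p
  obtain ⟨e, he0, heW, hef, hes⟩ := exists_openPartialHomeomorph_contDiffOn (f' := e₀.symm)
    h.isOpen h.mem h.contDiffOn (by rw [hAe]; exact h.hasFDerivAt_zero)
  have hex : e 0 = x₀ := by rw [hef, h.apply_base]
  have hx₀t : x₀ ∈ e.target := hex ▸ e.map_source he0
  have hex' : e.symm x₀ = 0 := by rw [← hex, e.left_inv he0]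
  have hU : IsOpen (e.target ∩ U₁) := e.open_target.inter hU₁
  let ρ : E → ℝ := fun x ↦ e.symm x (A x₀ (e.symm x))
  have hX1 : ∀ x ∈ e.target, X (e.symm x) 1 = x := fun x hx ↦ by rw [← hef, e.right_inv hx]
  have heW' : ∀ x ∈ e.target, e.symm x ∈ W := fun x hx ↦ heW (e.map_target hx)
  have h1I : (1 : ℝ) ∈ Icc (0 : ℝ) 1 := right_mem_Icc.2 zero_le_one
  refine ⟨ρ, e.target ∩ U₁, fun x hx ↦ hU₁₀ hx.2, hU, ⟨hx₀t, hx₁⟩, ?_, ?_, ?_, ?_, ?_⟩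
  · have h1 : ContDiffOn ℝ ∞ e.symm (e.target ∩ U₁) := hes.mono inter_subset_left
    exact h1.clm_apply ((A x₀).contDiff.comp_contDiffOn h1)
  · simp [ρ, hex']
  · intro x hx hne
    have hne' : A x₀ (e.symm x) ≠ 0 := by
      intro h0
      have h1 : e.symm x = 0 := by
        rw [← hGA x₀ hx₁ (e.symm x), h0, map_zero]
      apply hne
      rw [← hX1 x hx.1, h1, h.apply_base]
    change 0 < e.symm x (A x₀ (e.symm x))
    rw [hpA x₀ hx₁]
    exact hp x₀ hx₀ _ hne'
  · intro x hx v
    have hed : HasFDerivAt e.symm (fderiv ℝ e.symm x) x :=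
      ((hes.contDiffAt (e.open_target.mem_nhds hx.1)).differentiableAt (by simp)).hasFDerivAt
    have hρd := hed.clm_apply ((A x₀).hasFDerivAt.comp x hed)
    have hfd : HasFDerivAt (fun p ↦ X p 1) (fderiv ℝ (fun p ↦ X p 1) (e.symm x)) (e.symm x) :=
      ((h.contDiffOn.contDiffAt (h.isOpen.mem_nhds (heW' x hx.1))).differentiableAt
        (by simp)).hasFDerivAt
    have hid : fderiv ℝ (fun p ↦ X p 1) (e.symm x) (fderiv ℝ e.symm x v) = v := by
      have h2 : ((fun p ↦ X p 1) ∘ e.symm) =ᶠ[𝓝 x] id := by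
        filter_upwards [e.open_target.mem_nhds hx.1] with y hy using hX1 y hy
      exact DFunLike.congr_fun ((hfd.comp x hed).unique
        ((hasFDerivAt_id x).congr_of_eventuallyEq h2)) v
    have hY : fderiv ℝ ρ x v = 2 * Y (e.symm x) 1 v := by
      have h3 := h.gauss _ (heW' x hx.1) (fderiv ℝ e.symm x v)
      rw [hid] at h3
      rw [h3, show fderiv ℝ ρ x = _ from hρd.fderiv]
      simp only [add_apply, ContinuousLinearMap.coe_comp, Function.comp_apply,
        ContinuousLinearMap.flip_apply]
      rw [hAs x₀ (fderiv ℝ e.symm x v)]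
      ring
    have hE := h.energy _ (heW' x hx.1) 1 h1I
    rw [hX1 x hx.1] at hE
    have hx0 := hU₁₀ hx.2
    have hCS := sq_apply_le_of_symm_of_nonneg (hs x hx0) (hp x hx0)
      (A x (Y (e.symm x) 1)) v
    rw [← hpA x hx.2, hE, hGA x hx.2] at hCS
    rw [hY]
    change _ ≤ 4 * (e.symm x (A x₀ (e.symm x))) * G x v v
    nlinarith
  · intro O hO
    have h1 := h.eventually_mem _ (inter_mem hO (hU.mem_nhds ⟨hx₀t, hx₁⟩))
    have hc : Tendsto e.symm (𝓝 x₀) (𝓝 0) := by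
      have := e.continuousAt_symm hx₀t
      rwa [ContinuousAt, hex'] at this
    filter_upwards [hc.eventually h1, e.open_target.mem_nhds hx₀t] with x hx hxt
    have hW := heW' x hxt
    refine ⟨X (e.symm x), h.contDiff_curve _ hW, h.apply_zero _ hW, hX1 x hxt,
      fun t ht ↦ ⟨(hx t ht).1, ?_⟩⟩
    rw [(h.hasDerivAt _ hW t ht).deriv, ← hpA _ (hx t ht).2.2]
    exact h.energy _ hW t ht

end Eikonal

/-! ### Comparing a distance function with lengths of curves -/

section DistanceFunction

open MeasureTheory intervalIntegral

variable {E : Type*} [NormedAddCommGroup E] [NormedSpace ℝ E]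

/-- `w` is the distance to `x₀` of the metric `G` on the neighbourhood `U` of `x₀`: it is
`1`-Lipschitz infinitesimally, and it is attained by curves. -/
structure IsDistanceFunction (G : E → E →L[ℝ] E →L[ℝ] ℝ) (x₀ : E) (w : E → ℝ) (U : Set E) :
    Prop where
  isOpen : IsOpen U
  mem : x₀ ∈ U
  continuousOn_metric : ContinuousOn G U
  continuousOn : ContinuousOn w U
  apply_base : w x₀ = 0
  pos : ∀ x ∈ U, x ≠ x₀ → 0 < w x
  differentiableAt : ∀ x ∈ U, x ≠ x₀ → DifferentiableAt ℝ w x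
  fderiv_le : ∀ x ∈ U, x ≠ x₀ → ∀ v, fderiv ℝ w x v ≤ √(G x v v)
  attained : ∀ᶠ x in 𝓝 x₀, ∃ c : ℝ → E, ContDiff ℝ 1 c ∧ c 0 = x₀ ∧ c 1 = x ∧
    (∀ t ∈ Icc (0 : ℝ) 1, c t ∈ U) ∧
    ∫ t in (0 : ℝ)..1, √(G (c t) (deriv c t) (deriv c t)) = w x

variable {G : E → E →L[ℝ] E →L[ℝ] ℝ} {x₀ : E} {w : E → ℝ} {U : Set E}

lemma continuousOn_speed (hG : ContinuousOn G U) {c : ℝ → E} {a b : ℝ} (hab : a < b)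
    (hc : ContDiffOn ℝ 1 c (Icc a b)) (hcU : ∀ t ∈ Icc a b, c t ∈ U) :
    ContinuousOn (fun t ↦ √(G (c t) (derivWithin c (Icc a b) t) (derivWithin c (Icc a b) t)))
      (Icc a b) := by
  have h1 := hc.continuousOn_derivWithin (uniqueDiffOn_Icc hab) le_rfl
  exact (((hG.comp hc.continuousOn hcU).clm_apply h1).clm_apply h1).sqrt

/-- A distance function with these differential properties increases along a curve by at most the
length of the curve. -/
lemma sub_le_integral_speed (hU : ∀ x ∈ U, x ≠ x₀ → 0 < w x) (h0 : w x₀ = 0)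
    (hG : ContinuousOn G U) (hw : ContinuousOn w U)
    (hd : ∀ x ∈ U, x ≠ x₀ → DifferentiableAt ℝ w x)
    (hle : ∀ x ∈ U, x ≠ x₀ → ∀ v, fderiv ℝ w x v ≤ √(G x v v))
    {c : ℝ → E} {a b : ℝ} (hab : a < b)
    (hc : ContDiffOn ℝ 1 c (Icc a b)) (hcU : ∀ t ∈ Icc a b, c t ∈ U) :
    w (c b) - w (c a) ≤
      ∫ t in a..b, √(G (c t) (derivWithin c (Icc a b) t) (derivWithin c (Icc a b) t)) := by
  set φ : ℝ → ℝ := fun t ↦ √(G (c t) (derivWithin c (Icc a b) t) (derivWithin c (Icc a b) t))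
  have hφ : ContinuousOn φ (Icc a b) := continuousOn_speed hG hab hc hcU
  have hnn : ∀ x ∈ U, 0 ≤ w x := by
    intro x hx
    rcases eq_or_ne x x₀ with rfl | h
    · exact h0.ge
    · exact (hU x hx h).le
  -- the last time at which the curve passes through the base point
  obtain ⟨t₀, ht₀, hwt, hne⟩ : ∃ t₀ ∈ Icc a b, w (c t₀) ≤ w (c a) ∧ ∀ t ∈ Ioo t₀ b, c t ≠ x₀ := by
    have hZ : IsCompact (Icc a b ∩ c ⁻¹' {x₀}) :=
      isCompact_Icc.of_isClosed_subset
        (hc.continuousOn.preimage_isClosed_of_isClosed isClosed_Icc isClosed_singleton)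
        inter_subset_left
    rcases (Icc a b ∩ c ⁻¹' {x₀}).eq_empty_or_nonempty with hemp | hne
    · refine ⟨a, left_mem_Icc.2 hab.le, le_rfl, fun t ht h ↦ ?_⟩
      have : t ∈ Icc a b ∩ c ⁻¹' {x₀} := ⟨Ioo_subset_Icc_self ht, h⟩
      rw [hemp] at this
      exact this
    · obtain ⟨t₀, ht₀, hmax⟩ := hZ.exists_isGreatest hne
      refine ⟨t₀, ht₀.1, ?_, fun t ht h ↦ ?_⟩
      · rw [show c t₀ = x₀ from ht₀.2, h0]
        exact hnn _ (hcU a (left_mem_Icc.2 hab.le))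
      · exact absurd (hmax ⟨⟨ht₀.1.1.trans ht.1.le, ht.2.le⟩, h⟩) (not_le.2 ht.1)
  have hsub : Icc t₀ b ⊆ Icc a b := Icc_subset_Icc_left ht₀.1
  -- On `Ioo t₀ b` the curve avoids `x₀`, the only point where `w` may fail to be differentiable.
  -- Starting at `t₀` loses nothing, as `w (c t₀) ≤ w (c a)`.
  have key : w (c b) - w (c t₀) ≤ ∫ t in t₀..b, φ t := by
    refine sub_le_integral_of_hasDeriv_right_of_le (g := fun t ↦ w (c t))
      (g' := fun t ↦ fderiv ℝ w (c t) (derivWithin c (Icc a b) t)) ht₀.2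
      ((hw.comp hc.continuousOn hcU).mono hsub) ?_ ((hφ.mono hsub).integrableOn_Icc) ?_
    · intro t ht
      have htI : t ∈ Icc a b := hsub (Ioo_subset_Icc_self ht)
      have hn : Icc a b ∈ 𝓝 t := Icc_mem_nhds (ht₀.1.trans_lt ht.1) ht.2
      have h1 : HasDerivAt c (derivWithin c (Icc a b) t) t :=
        ((hc.differentiableOn one_ne_zero t htI).hasDerivWithinAt).hasDerivAt hn
      exact ((hd (c t) (hcU t htI) (hne t ht)).hasFDerivAt.comp_hasDerivAt t h1).hasDerivWithinAt
    · intro t ht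
      exact hle (c t) (hcU t (hsub (Ioo_subset_Icc_self ht))) (hne t ht) _
  have hint : ∫ t in t₀..b, φ t ≤ ∫ t in a..b, φ t := by
    refine integral_mono_interval ht₀.1 ht₀.2 le_rfl
      (ae_of_all _ fun t ↦ Real.sqrt_nonneg _) ?_
    exact hφ.intervalIntegrable_of_Icc hab.le
  linarith

end DistanceFunction

/-! ### The metric in the preferred chart -/

section Coordinates

open MeasureTheory

variable {m : ℕ} {M : Type*} [TopologicalSpace M] [ChartedSpace (EuclideanSpace ℝ (Fin m)) M]

/-- The metric `g` in the coordinates of the preferred chart at `P`. -/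
noncomputable def coordMetric (g : BilinField m M) (P : M) (y : EuclideanSpace ℝ (Fin m)) :
    EuclideanSpace ℝ (Fin m) →L[ℝ] EuclideanSpace ℝ (Fin m) →L[ℝ] ℝ :=
  let B : EuclideanSpace ℝ (Fin m) →L[ℝ] EuclideanSpace ℝ (Fin m) →L[ℝ] ℝ :=
    g ((extChartAt (𝓡 m) P).symm y)
  let L : EuclideanSpace ℝ (Fin m) →L[ℝ] EuclideanSpace ℝ (Fin m) :=
    mfderiv (𝓡 m) (𝓡 m) (extChartAt (𝓡 m) P).symm y
  B.bilinearComp L L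

lemma gram_apply (g : BilinField m M) (P : M) (y : EuclideanSpace ℝ (Fin m)) (i j : Fin m) :
    gram g P y i j = coordMetric g P y (EuclideanSpace.single i 1) (EuclideanSpace.single j 1) :=
  rfl

variable [IsManifold (𝓡 m) ∞ M]

lemma mdifferentiableAt_extChartAt_symm {P : M} {y : EuclideanSpace ℝ (Fin m)}
    (hy : y ∈ (extChartAt (𝓡 m) P).target) :
    MDifferentiableAt (𝓡 m) (𝓡 m) (extChartAt (𝓡 m) P).symm y :=
  ((contMDiffOn_extChartAt_symm (n := ∞) P).contMDiffAt
    ((isOpen_extChartAt_target P).mem_nhds hy)).mdifferentiableAt (by simp)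

lemma injective_mfderiv_extChartAt_symm {P : M} {y : EuclideanSpace ℝ (Fin m)}
    (hy : y ∈ (extChartAt (𝓡 m) P).target) :
    Function.Injective (mfderiv (𝓡 m) (𝓡 m) (extChartAt (𝓡 m) P).symm y) := by
  have : IsManifold (𝓡 m) 1 M := IsManifold.of_le (n := ∞) (by simp)
  have h := isInvertible_mfderivWithin_extChartAt_symm (I := 𝓡 m) (x := P) hy
  rw [show range (𝓡 m) = univ by simp, mfderivWithin_univ] at h
  exact h.injective

lemma contMDiffOn_mfderiv_extChartAt_symm_apply (P : M) (v : EuclideanSpace ℝ (Fin m)) :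
    ContMDiffOn (𝓡 m) (𝓡 m).tangent ∞
      (fun y ↦ Bundle.TotalSpace.mk' (EuclideanSpace ℝ (Fin m)) (E := TangentSpace (𝓡 m) (M := M))
        ((extChartAt (𝓡 m) P).symm y) (mfderiv (𝓡 m) (𝓡 m) (extChartAt (𝓡 m) P).symm y v))
      (extChartAt (𝓡 m) P).target := by
  have ho := isOpen_extChartAt_target (I := 𝓡 m) P
  have h1 := (contMDiffOn_extChartAt_symm (I := 𝓡 m) (n := ∞) P).contMDiffOn_tangentMapWithin
    (m := ∞) (by simp) ho.uniqueMDiffOn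
  have h2 : ContMDiffOn (𝓡 m) (𝓡 m).tangent ∞
      (fun y ↦ Bundle.TotalSpace.mk' (EuclideanSpace ℝ (Fin m))
        (E := TangentSpace (𝓡 m) (M := EuclideanSpace ℝ (Fin m))) y v)
      (extChartAt (𝓡 m) P).target := by
    intro y _
    exact (contMDiffAt_vectorSpace_iff_contDiffAt.2 contDiffAt_const).contMDiffWithinAt
  refine (h1.comp h2 fun y hy ↦ hy).congr fun y hy ↦ ?_
  simp only [Function.comp_apply, tangentMapWithin, mfderivWithin_of_isOpen ho hy]

lemma exists_contDiffOn_coordMetric {g : BilinField m M} {P : M} (hg : IsRiemannianNear g P) :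
    ∃ U : Set (EuclideanSpace ℝ (Fin m)), IsOpen U ∧ extChartAt (𝓡 m) P P ∈ U ∧
      U ⊆ (extChartAt (𝓡 m) P).target ∧ ContDiffOn ℝ ∞ (coordMetric g P) U ∧
      (∀ y ∈ U, ∀ v w, coordMetric g P y v w = coordMetric g P y w v) ∧
      (∀ y ∈ U, ∀ v, v ≠ 0 → 0 < coordMetric g P y v v) := by
  have ho := isOpen_extChartAt_target (I := 𝓡 m) P
  obtain ⟨O, hO, hOo, hPO⟩ := eventually_nhds_iff.1 hg
  have hcs := continuousOn_extChartAt_symm (I := 𝓡 m) P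
  have hU : IsOpen ((extChartAt (𝓡 m) P).target ∩ (extChartAt (𝓡 m) P).symm ⁻¹' O) :=
    hcs.isOpen_inter_preimage ho hOo
  refine ⟨_, hU, ⟨mem_extChartAt_target P, by simpa using hPO⟩, inter_subset_left, ?_, ?_, ?_⟩
  · rw [contDiffOn_clm_apply]
    intro v
    rw [contDiffOn_clm_apply]
    intro w y hy
    apply ContDiffAt.contDiffWithinAt
    rw [← contMDiffAt_iff_contDiffAt]
    have hs := (contMDiffOn_extChartAt_symm (I := 𝓡 m) (n := ∞) P).contMDiffAt (ho.mem_nhds hy.1)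
    have h1 := (hO _ hy.2).2.2.comp y hs
    have h2 := (contMDiffOn_mfderiv_extChartAt_symm_apply P v).contMDiffAt (ho.mem_nhds hy.1)
    have h3 := (contMDiffOn_mfderiv_extChartAt_symm_apply P w).contMDiffAt (ho.mem_nhds hy.1)
    have h4 := ContMDiffAt.clm_bundle_apply₂ (E₃ := fun _ : M ↦ ℝ) (F₃ := ℝ)
      (b := (extChartAt (𝓡 m) P).symm) h1 h2 h3
    exact (Bundle.contMDiffAt_totalSpace.1 h4).2
  · intro y hy v w
    exact (hO _ hy.2).1 _ _
  · intro y hy v hv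
    refine (hO _ hy.2).2.1 _ fun h ↦ hv ?_
    exact injective_mfderiv_extChartAt_symm hy.1 (h.trans (map_zero _).symm)

end Coordinates

/-! ### Geodesic distance on the manifold from local data -/

section CurveLength

open MeasureTheory

variable {m : ℕ} {M : Type*} [TopologicalSpace M] [ChartedSpace (EuclideanSpace ℝ (Fin m)) M]

/-- The Hausdorff property makes the image `K` of the closed coordinate ball closed in `M`. At the
first exit time from the open ball the curve is therefore still in `K`, hence in the chart and on
the sphere. -/
lemma forall_mem_or_exists_exit [T2Space M] {P : M} {r : ℝ} (hr : 0 < r)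
    (hball : Metric.closedBall (extChartAt (𝓡 m) P P) r ⊆ (extChartAt (𝓡 m) P).target)
    {γ : ℝ → M} (hγ : ContinuousOn γ (Icc 0 1)) (hγ0 : γ 0 = P) :
    (∀ t ∈ Icc (0 : ℝ) 1, γ t ∈ (extChartAt (𝓡 m) P).source ∧
      extChartAt (𝓡 m) P (γ t) ∈ Metric.ball (extChartAt (𝓡 m) P P) r) ∨
    ∃ T ∈ Icc (0 : ℝ) 1, (∀ t ∈ Icc 0 T, γ t ∈ (extChartAt (𝓡 m) P).source ∧
      extChartAt (𝓡 m) P (γ t) ∈ Metric.closedBall (extChartAt (𝓡 m) P P) r) ∧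
      extChartAt (𝓡 m) P (γ T) ∈ Metric.sphere (extChartAt (𝓡 m) P P) r := by
  set φ := extChartAt (𝓡 m) P with hφ
  let N : Set M := φ.source ∩ φ ⁻¹' Metric.ball (φ P) r
  have hN : IsOpen N := (continuousOn_extChartAt P).isOpen_inter_preimage
    (isOpen_extChartAt_source P) Metric.isOpen_ball
  let K : Set M := φ.symm '' Metric.closedBall (φ P) r
  have hK : IsClosed K := ((isCompact_closedBall _ _).image_of_continuousOn
    ((continuousOn_extChartAt_symm P).mono hball)).isClosed
  have hKm : ∀ x ∈ K, x ∈ φ.source ∧ φ x ∈ Metric.closedBall (φ P) r := by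
    rintro _ ⟨y, hy, rfl⟩
    exact ⟨φ.map_target (hball hy), by rwa [φ.right_inv (hball hy)]⟩
  have hNK : N ⊆ K := fun x hx ↦ ⟨φ x, Metric.ball_subset_closedBall hx.2, φ.left_inv hx.1⟩
  by_cases hall : ∀ t ∈ Icc (0 : ℝ) 1, γ t ∈ N
  · exact Or.inl hall
  right
  have hS : IsCompact (Icc (0 : ℝ) 1 ∩ γ ⁻¹' Nᶜ) :=
    isCompact_Icc.of_isClosed_subset
      (hγ.preimage_isClosed_of_isClosed isClosed_Icc hN.isClosed_compl) inter_subset_left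
  push Not at hall
  obtain ⟨t₁, ht₁, ht₁N⟩ := hall
  obtain ⟨T, hT, hmin⟩ := hS.exists_isLeast ⟨t₁, ht₁, ht₁N⟩
  have hP : γ 0 ∈ N := by
    rw [hγ0]
    exact ⟨mem_extChartAt_source P, Metric.mem_ball_self hr⟩
  have hT0 : 0 < T := hT.1.1.lt_of_ne fun h ↦ hT.2 (h ▸ hP)
  have hsub : Icc 0 T ⊆ Icc (0 : ℝ) 1 ∩ γ ⁻¹' K := by
    rw [← closure_Ico hT0.ne]
    refine closure_minimal (fun t ht ↦ ?_) (hγ.preimage_isClosed_of_isClosed isClosed_Icc hK)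
    have htI : t ∈ Icc (0 : ℝ) 1 := ⟨ht.1, ht.2.le.trans hT.1.2⟩
    refine ⟨htI, hNK ?_⟩
    by_contra h
    exact absurd (hmin ⟨htI, h⟩) (not_le.2 ht.2)
  refine ⟨T, hT.1, fun t ht ↦ hKm _ (hsub ht).2, ?_⟩
  have hTK := hKm _ (hsub (right_mem_Icc.2 hT0.le)).2
  rw [Metric.mem_sphere]
  refine le_antisymm hTK.2 (not_lt.1 fun h ↦ hT.2 ⟨hTK.1, h⟩)

lemma eventually_mem_extChartAt_ball {P : M} {r : ℝ} (hr : 0 < r) :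
    ∀ᶠ Q in 𝓝 P, Q ∈ (extChartAt (𝓡 m) P).source ∧
      extChartAt (𝓡 m) P Q ∈ Metric.ball (extChartAt (𝓡 m) P P) r :=
  Eventually.and ((isOpen_extChartAt_source P).mem_nhds (mem_extChartAt_source P))
    ((continuousAt_extChartAt P).eventually (Metric.ball_mem_nhds _ hr))

variable [IsManifold (𝓡 m) ∞ M]

lemma speed_eq_coordMetric (g : BilinField m M) {P : M} {γ : ℝ → M}
    {c : ℝ → EuclideanSpace ℝ (Fin m)} {t : ℝ}
    (hγ : γ =ᶠ[𝓝 t] (extChartAt (𝓡 m) P).symm ∘ c) (hc : DifferentiableAt ℝ c t)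
    (hct : c t ∈ (extChartAt (𝓡 m) P).target) :
    g (γ t) (mfderiv 𝓘(ℝ, ℝ) (𝓡 m) γ t (1 : ℝ)) (mfderiv 𝓘(ℝ, ℝ) (𝓡 m) γ t (1 : ℝ)) =
      coordMetric g P (c t) (deriv c t) (deriv c t) := by
  have hpt : γ t = (extChartAt (𝓡 m) P).symm (c t) := hγ.self_of_nhds
  have h1 : HasMFDerivAt 𝓘(ℝ, ℝ) (𝓡 m) ((extChartAt (𝓡 m) P).symm ∘ c) t
      ((mfderiv (𝓡 m) (𝓡 m) (extChartAt (𝓡 m) P).symm (c t)).comp (fderiv ℝ c t)) :=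
    (mdifferentiableAt_extChartAt_symm hct).hasMFDerivAt.comp t hc.hasFDerivAt.hasMFDerivAt
  have h2 := (h1.congr_of_eventuallyEq hγ).mfderiv
  -- The tangent spaces at `γ t` and at `(extChartAt (𝓡 m) P).symm (c t)` are different types;
  -- regarding both as the model space allows rewriting along the equality of base points.
  have key : ∀ x y : M, x = y → ∀ u v : EuclideanSpace ℝ (Fin m), u = v →
      (g x : EuclideanSpace ℝ (Fin m) →L[ℝ] EuclideanSpace ℝ (Fin m) →L[ℝ] ℝ) u u =
      (g y : EuclideanSpace ℝ (Fin m) →L[ℝ] EuclideanSpace ℝ (Fin m) →L[ℝ] ℝ) v v := by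
    rintro x _ rfl u _ rfl
    rfl
  refine key _ _ hpt _ _ ?_
  exact DFunLike.congr_fun h2 (1 : ℝ)

variable {g : BilinField m M} {P : M} {U : Set (EuclideanSpace ℝ (Fin m))}
  {w : EuclideanSpace ℝ (Fin m) → ℝ}

lemma curveLength_extChartAt_symm_comp (hG : ContinuousOn (coordMetric g P) U)
    (hUt : U ⊆ (extChartAt (𝓡 m) P).target) {c : ℝ → EuclideanSpace ℝ (Fin m)}
    (hc : ContDiff ℝ 1 c) (hcU : ∀ t ∈ Icc (0 : ℝ) 1, c t ∈ U) :
    curveLength g ((extChartAt (𝓡 m) P).symm ∘ c) =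
      ENNReal.ofReal (∫ t in (0 : ℝ)..1, √(coordMetric g P (c t) (deriv c t) (deriv c t))) := by
  have hd : ContinuousOn (deriv c) (Icc 0 1) := (hc.continuous_deriv le_rfl).continuousOn
  have hcont : ContinuousOn (fun t ↦ √(coordMetric g P (c t) (deriv c t) (deriv c t)))
      (Icc 0 1) :=
    (((hG.comp hc.continuous.continuousOn hcU).clm_apply hd).clm_apply hd).sqrt
  rw [intervalIntegral.integral_of_le zero_le_one, ← integral_Icc_eq_integral_Ioc,
    ofReal_integral_eq_lintegral_ofReal hcont.integrableOn_Icc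
      (ae_of_all _ fun t ↦ Real.sqrt_nonneg _)]
  refine setLIntegral_congr_fun measurableSet_Icc fun t ht ↦ ?_
  exact congrArg (fun x ↦ ENNReal.ofReal √x) (speed_eq_coordMetric g (c := c) EventuallyEq.rfl
    (hc.differentiable one_ne_zero t) (hUt (hcU t ht)))

lemma le_curveLength (hw : IsDistanceFunction (coordMetric g P) (extChartAt (𝓡 m) P P) w U)
    (hUt : U ⊆ (extChartAt (𝓡 m) P).target) {γ : ℝ → M}
    (hγ : ContMDiffOn 𝓘(ℝ, ℝ) (𝓡 m) 1 γ (Icc 0 1)) (hγ0 : γ 0 = P) {T : ℝ}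
    (hT : T ∈ Icc (0 : ℝ) 1)
    (hγU : ∀ t ∈ Icc 0 T, γ t ∈ (extChartAt (𝓡 m) P).source ∧ extChartAt (𝓡 m) P (γ t) ∈ U) :
    ENNReal.ofReal (w (extChartAt (𝓡 m) P (γ T))) ≤ curveLength g γ := by
  rcases hT.1.eq_or_lt with rfl | hT0
  · rw [hγ0, hw.apply_base]
    simp
  let c : ℝ → EuclideanSpace ℝ (Fin m) := extChartAt (𝓡 m) P ∘ γ
  have hsub : Icc 0 T ⊆ Icc (0 : ℝ) 1 := Icc_subset_Icc_right hT.2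
  have : IsManifold (𝓡 m) 1 M := IsManifold.of_le (n := ∞) (by simp)
  have hc : ContDiffOn ℝ 1 c (Icc 0 T) := by
    rw [← contMDiffOn_iff_contDiffOn]
    refine (contMDiffOn_extChartAt (I := 𝓡 m) (n := 1) (x := P)).comp (hγ.mono hsub) fun t ht ↦ ?_
    have := (hγU t ht).1
    rwa [extChartAt_source] at this
  have hcU : ∀ t ∈ Icc 0 T, c t ∈ U := fun t ht ↦ (hγU t ht).2
  have h1 := sub_le_integral_speed hw.pos hw.apply_base hw.continuousOn_metric hw.continuousOn
    hw.differentiableAt hw.fderiv_le hT0 hc hcU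
  have hc0 : c 0 = extChartAt (𝓡 m) P P := by simp only [c, Function.comp_apply, hγ0]
  rw [hc0, hw.apply_base, sub_zero] at h1
  have hcont := continuousOn_speed hw.continuousOn_metric hT0 hc hcU
  refine (ENNReal.ofReal_le_ofReal h1).trans ?_
  -- `curveLength` uses the two-sided derivative, but `γ` is only known to be `C¹` within `Icc 0 1`.
  -- On the open interval the two derivatives agree, and the endpoints have measure zero.
  rw [intervalIntegral.integral_of_le hT0.le, integral_Ioc_eq_integral_Ioo,
    ofReal_integral_eq_lintegral_ofReal (hcont.integrableOn_Icc.mono_set Ioo_subset_Icc_self)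
      (ae_of_all _ fun t ↦ Real.sqrt_nonneg _)]
  refine le_trans (le_of_eq ?_) (lintegral_mono_set (Ioo_subset_Icc_self.trans hsub))
  refine setLIntegral_congr_fun measurableSet_Ioo fun t ht ↦ ?_
  have htI := Ioo_subset_Icc_self ht
  have hn : Icc 0 T ∈ 𝓝 t := Icc_mem_nhds ht.1 ht.2
  have hct : ContDiffAt ℝ 1 c t := hc.contDiffAt hn
  rw [derivWithin_of_mem_nhds hn]
  refine congrArg (fun x ↦ ENNReal.ofReal √x) (speed_eq_coordMetric g (c := c) ?_
    (hct.differentiableAt one_ne_zero) (hUt (hcU t htI))).symm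
  filter_upwards [hn] with s hs
  exact ((extChartAt (𝓡 m) P).left_inv (hγU s hs).1).symm

/-- Lower bounds for the geodesic distance, inside and outside a small coordinate ball. -/
lemma exists_le_geodesicEDist [T2Space M]
    (hw : IsDistanceFunction (coordMetric g P) (extChartAt (𝓡 m) P P) w U)
    (hUt : U ⊆ (extChartAt (𝓡 m) P).target) {r : ℝ} (hr : 0 < r)
    (hball : Metric.closedBall (extChartAt (𝓡 m) P P) r ⊆ U) :
    ∃ ε > 0, ∀ Q,
      ((Q ∈ (extChartAt (𝓡 m) P).source ∧
        extChartAt (𝓡 m) P Q ∈ Metric.ball (extChartAt (𝓡 m) P P) r) →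
        ENNReal.ofReal (min ε (w (extChartAt (𝓡 m) P Q))) ≤ geodesicEDist g P Q) ∧
      (¬ (Q ∈ (extChartAt (𝓡 m) P).source ∧
        extChartAt (𝓡 m) P Q ∈ Metric.ball (extChartAt (𝓡 m) P P) r) →
        ENNReal.ofReal ε ≤ geodesicEDist g P Q) := by
  set φ := extChartAt (𝓡 m) P with hφ
  obtain ⟨ε, hε, hεw⟩ : ∃ ε > 0, ∀ y ∈ Metric.sphere (φ P) r, ε ≤ w y := by
    -- Any curve leaving the ball has length at least the minimum of `w` over the sphere. The sphere
    -- is empty only in dimension zero, where any positive `ε` serves.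
    rcases (Metric.sphere (φ P) r).eq_empty_or_nonempty with h | h
    · exact ⟨1, one_pos, fun y hy ↦ by rw [h] at hy; exact hy.elim⟩
    · obtain ⟨y, hy, hmin⟩ := (isCompact_sphere (φ P) r).exists_isMinOn h
        (hw.continuousOn.mono (Metric.sphere_subset_closedBall.trans hball))
      refine ⟨w y, hw.pos y (hball (Metric.sphere_subset_closedBall hy)) ?_, hmin⟩
      rintro rfl
      rw [Metric.mem_sphere, dist_self] at hy
      exact hr.ne hy
  have hex : ∀ γ : ℝ → M, ContMDiffOn 𝓘(ℝ, ℝ) (𝓡 m) 1 γ (Icc 0 1) → γ 0 = P →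
      (∀ t ∈ Icc (0 : ℝ) 1, γ t ∈ φ.source ∧ φ (γ t) ∈ Metric.ball (φ P) r) ∨
      ENNReal.ofReal ε ≤ curveLength g γ := by
    intro γ hγ hγ0
    rcases forall_mem_or_exists_exit hr (hball.trans hUt) hγ.continuousOn hγ0 with h | h
    · exact Or.inl h
    · obtain ⟨T, hT, h1, h2⟩ := h
      refine Or.inr ((ENNReal.ofReal_le_ofReal (hεw _ h2)).trans ?_)
      exact le_curveLength hw hUt hγ hγ0 hT fun t ht ↦ ⟨(h1 t ht).1, hball (h1 t ht).2⟩
  refine ⟨ε, hε, fun Q ↦ ⟨fun hQ ↦ ?_, fun hQ ↦ ?_⟩⟩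
  · refine le_iInf fun γ ↦ le_iInf fun hγ ↦ le_iInf fun hγ0 ↦ le_iInf fun hγ1 ↦ ?_
    rcases hex γ hγ hγ0 with h | h
    · refine (ENNReal.ofReal_le_ofReal (min_le_right _ _)).trans ?_
      rw [← hγ1]
      exact le_curveLength hw hUt hγ hγ0 (right_mem_Icc.2 zero_le_one)
        fun t ht ↦ ⟨(h t ht).1, hball (Metric.ball_subset_closedBall (h t ht).2)⟩
    · exact (ENNReal.ofReal_le_ofReal (min_le_left _ _)).trans h
  · refine le_iInf fun γ ↦ le_iInf fun hγ ↦ le_iInf fun hγ0 ↦ le_iInf fun hγ1 ↦ ?_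
    rcases hex γ hγ hγ0 with h | h
    · exact absurd (hγ1 ▸ h 1 (right_mem_Icc.2 zero_le_one)) hQ
    · exact h

/-- The attaining curve bounds the distance from above. For the lower bound, a curve inside the
coordinate ball has length at least `w`, and a curve leaving it has length at least `ε`, which
exceeds `w` close to `P`. -/
theorem IsDistanceFunction.eventually_geodesicDist_eq [T2Space M]
    (hw : IsDistanceFunction (coordMetric g P) (extChartAt (𝓡 m) P P) w U)
    (hUt : U ⊆ (extChartAt (𝓡 m) P).target) :
    ∀ᶠ Q in 𝓝 P, geodesicDist g P Q = w (extChartAt (𝓡 m) P Q) := by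
  obtain ⟨r, hr, hball⟩ := Metric.nhds_basis_closedBall.mem_iff.1 (hw.isOpen.mem_nhds hw.mem)
  obtain ⟨ε, hε, hlow⟩ := exists_le_geodesicEDist hw hUt hr hball
  have hwc : ContinuousAt w (extChartAt (𝓡 m) P P) :=
    hw.continuousOn.continuousAt (hw.isOpen.mem_nhds hw.mem)
  have hwε : ∀ᶠ y in 𝓝 (extChartAt (𝓡 m) P P), w y < ε :=
    hwc.eventually (gt_mem_nhds (by rwa [hw.apply_base]))
  filter_upwards [eventually_mem_extChartAt_ball (m := m) hr,
    (continuousAt_extChartAt P).eventually hwε,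
    (continuousAt_extChartAt P).eventually hw.attained] with Q hQ hQε hQc
  have hQU : extChartAt (𝓡 m) P Q ∈ U := hball (Metric.ball_subset_closedBall hQ.2)
  have hnn : 0 ≤ w (extChartAt (𝓡 m) P Q) := by
    rcases eq_or_ne (extChartAt (𝓡 m) P Q) (extChartAt (𝓡 m) P P) with h | h
    · rw [h, hw.apply_base]
    · exact (hw.pos _ hQU h).le
  suffices h : geodesicEDist g P Q = ENNReal.ofReal (w (extChartAt (𝓡 m) P Q)) by
    rw [geodesicDist, h, ENNReal.toReal_ofReal hnn]
  refine le_antisymm ?_ ?_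
  · obtain ⟨c, hc, hc0, hc1, hcU, hlen⟩ := hQc
    refine iInf_le_of_le ((extChartAt (𝓡 m) P).symm ∘ c) (iInf_le_of_le ?_ (iInf_le_of_le ?_
      (iInf_le_of_le ?_ ?_)))
    · have : IsManifold (𝓡 m) 1 M := IsManifold.of_le (n := ∞) (by simp)
      exact (contMDiffOn_extChartAt_symm P).comp hc.contMDiff.contMDiffOn
        fun t ht ↦ hUt (hcU t ht)
    · simp [hc0]
    · simp only [Function.comp_apply, hc1]
      exact (extChartAt (𝓡 m) P).left_inv hQ.1
    · rw [curveLength_extChartAt_symm_comp hw.continuousOn_metric hUt hc hcU, hlen]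
  · have := (hlow Q).1 hQ
    rwa [min_eq_right hQε.le] at this

/-- Small punctured geodesic balls lie in any given neighbourhood of `P`, since points outside a
coordinate ball have distance at least `ε`. Positivity of the distance is essential: points not
joined to `P` by a curve of finite length get the value `0`. -/
theorem IsDistanceFunction.exists_mem_of_geodesicDist_lt [T2Space M]
    (hw : IsDistanceFunction (coordMetric g P) (extChartAt (𝓡 m) P P) w U)
    (hUt : U ⊆ (extChartAt (𝓡 m) P).target) {p : M → Prop} (hp : ∀ᶠ Q in 𝓝 P, p Q) :
    ∃ ε > 0, ∀ Q, 0 < geodesicDist g P Q → geodesicDist g P Q < ε → p Q := by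
  have h1 : ∀ᶠ y in 𝓝 (extChartAt (𝓡 m) P P), y ∈ U ∧ p ((extChartAt (𝓡 m) P).symm y) := by
    refine Eventually.and (hw.isOpen.mem_nhds hw.mem) ?_
    have hc := continuousAt_extChartAt_symm (I := 𝓡 m) P
    rw [ContinuousAt, extChartAt_to_inv] at hc
    exact hc.eventually hp
  obtain ⟨r, hr, hball⟩ := Metric.nhds_basis_closedBall.mem_iff.1 h1
  obtain ⟨ε, hε, hlow⟩ := exists_le_geodesicEDist hw hUt hr fun y hy ↦ (hball hy).1
  refine ⟨ε, hε, fun Q hQ0 hQ ↦ ?_⟩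
  by_contra hpQ
  have hfin : geodesicEDist g P Q ≠ ⊤ := by
    intro h
    rw [geodesicDist, h] at hQ0
    simp at hQ0
  have h2 : ¬ (Q ∈ (extChartAt (𝓡 m) P).source ∧
      extChartAt (𝓡 m) P Q ∈ Metric.ball (extChartAt (𝓡 m) P P) r) := by
    intro h
    apply hpQ
    have := (hball (Metric.ball_subset_closedBall h.2)).2
    rwa [(extChartAt (𝓡 m) P).left_inv h.1] at this
  have h3 := ENNReal.toReal_mono hfin ((hlow Q).2 h2)
  rw [ENNReal.toReal_ofReal hε.le] at h3
  exact absurd h3 (not_le.2 hQ)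

end CurveLength

/-! ### Primitives on open intervals -/

section RadialPrimitive

open MeasureTheory intervalIntegral

variable {a : ℝ → ℝ} {δ : ℝ}

lemma hasDerivAt_primitive_of_continuousOn {I : Set ℝ} (hI : IsOpen I) (hc : I.OrdConnected)
    (ha : ContinuousOn a I) {r₀ r : ℝ} (hr₀ : r₀ ∈ I) (hr : r ∈ I) :
    HasDerivAt (fun r ↦ ∫ s in r₀..r, a s) (a r) r :=
  integral_hasDerivAt_right ((ha.mono (hc.uIcc_subset hr₀ hr)).intervalIntegrable)
    (ha.stronglyMeasurableAtFilter hI r hr) (ha.continuousAt (hI.mem_nhds hr))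

lemma contDiffOn_primitive {I : Set ℝ} (hI : IsOpen I) (hc : I.OrdConnected)
    (ha : ContDiffOn ℝ ∞ a I) {r₀ : ℝ} (hr₀ : r₀ ∈ I) :
    ContDiffOn ℝ ∞ (fun r ↦ ∫ s in r₀..r, a s) I := by
  have hd := fun r hr ↦ hasDerivAt_primitive_of_continuousOn hI hc ha.continuousOn hr₀ (r := r) hr
  rw [contDiffOn_infty_iff_deriv_of_isOpen hI]
  exact ⟨fun r hr ↦ (hd r hr).differentiableAt.differentiableWithinAt,
    ha.congr fun r hr ↦ (hd r hr).deriv⟩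

lemma strictMonoOn_primitive {I : Set ℝ} (hI : IsOpen I) (hc : I.OrdConnected)
    (ha : ContinuousOn a I) (hpos : ∀ s ∈ I, 0 < a s) {r₀ : ℝ} (hr₀ : r₀ ∈ I) :
    StrictMonoOn (fun r ↦ ∫ s in r₀..r, a s) I := by
  have hd := fun r hr ↦ hasDerivAt_primitive_of_continuousOn hI hc ha hr₀ (r := r) hr
  refine strictMonoOn_of_deriv_pos hc.convex (fun r hr ↦ (hd r hr).continuousAt.continuousWithinAt)
    fun r hr ↦ ?_
  have hr' := interior_subset hr
  rw [(hd r hr').deriv]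
  exact hpos r hr'

end RadialPrimitive

/-! ### Distance functions of radial conformal metrics -/

section ConformalDistance

open MeasureTheory intervalIntegral

variable {E : Type*} [NormedAddCommGroup E] [NormedSpace ℝ E]
  {G : E → E →L[ℝ] E →L[ℝ] ℝ} {x₀ : E} {ρ : E → ℝ} {U : Set E}

namespace IsSquaredDistance

lemma hasFDerivAt_sqrt (h : IsSquaredDistance G x₀ ρ U) {x : E} (hx : x ∈ U) (hne : x ≠ x₀) :
    HasFDerivAt (fun x ↦ √(ρ x)) ((1 / (2 * √(ρ x))) • fderiv ℝ ρ x) x :=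
  ((h.contDiffOn.contDiffAt (h.isOpen.mem_nhds hx)).differentiableAt
    (by simp)).hasFDerivAt.sqrt (h.pos x hx hne).ne'

lemma fderiv_sqrt_apply_le (h : IsSquaredDistance G x₀ ρ U) {x : E} (hx : x ∈ U) (hne : x ≠ x₀)
    (v : E) : (1 / (2 * √(ρ x))) * fderiv ℝ ρ x v ≤ √(G x v v) := by
  have hρ := h.pos x hx hne
  have hs : 0 < √(ρ x) := Real.sqrt_pos.2 hρ
  have h1 : fderiv ℝ ρ x v ≤ 2 * √(ρ x) * √(G x v v) := by
    refine (Real.le_sqrt_of_sq_le (h.eikonal x hx v)).trans (le_of_eq ?_)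
    rw [Real.sqrt_mul (by positivity), Real.sqrt_mul (by norm_num),
      show (4 : ℝ) = 2 ^ 2 by norm_num, Real.sqrt_sq (by norm_num)]
  rw [one_div, inv_mul_le_iff₀ (by positivity)]
  exact h1

lemma continuousOn_sqrt (h : IsSquaredDistance G x₀ ρ U) : ContinuousOn (fun x ↦ √(ρ x)) U :=
  h.contDiffOn.continuousOn.sqrt

/-- The distance to the base point is linear along geodesics. -/
lemma sqrt_apply_geodesic (h : IsSquaredDistance G x₀ ρ U) (hG : ContinuousOn G U) {x : E}
    {c : ℝ → E} (hc : ContDiff ℝ 1 c) (hc0 : c 0 = x₀) (hc1 : c 1 = x)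
    (hcU : ∀ t ∈ Icc (0 : ℝ) 1, c t ∈ U)
    (hcG : ∀ t ∈ Icc (0 : ℝ) 1, G (c t) (deriv c t) (deriv c t) = ρ x) {t : ℝ}
    (ht : t ∈ Icc (0 : ℝ) 1) : √(ρ (c t)) = t * √(ρ x) := by
  have key : ∀ a b : ℝ, a ∈ Icc (0 : ℝ) 1 → b ∈ Icc (0 : ℝ) 1 → a ≤ b →
      √(ρ (c b)) - √(ρ (c a)) ≤ (b - a) * √(ρ x) := by
    intro a b ha hb hab
    rcases hab.eq_or_lt with rfl | hab
    · simp
    have hsub : Icc a b ⊆ Icc (0 : ℝ) 1 := Icc_subset_Icc ha.1 hb.2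
    have h1 := sub_le_integral_speed (w := fun x ↦ √(ρ x)) (G := G) (U := U) (x₀ := x₀)
      (fun y hy hne ↦ Real.sqrt_pos.2 (h.pos y hy hne)) (by simp [h.apply_base]) hG
      h.continuousOn_sqrt (fun y hy hne ↦ (h.hasFDerivAt_sqrt hy hne).differentiableAt)
      (fun y hy hne v ↦ by
        rw [(h.hasFDerivAt_sqrt hy hne).fderiv]
        exact h.fderiv_sqrt_apply_le hy hne v) hab hc.contDiffOn fun t ht ↦ hcU t (hsub ht)
    refine h1.trans (le_of_eq ?_)
    rw [integral_congr (g := fun _ ↦ √(ρ x)), intervalIntegral.integral_const, smul_eq_mul]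
    intro t ht
    rw [uIcc_of_le hab.le] at ht
    have h2 : derivWithin c (Icc a b) t = deriv c t :=
      (hc.differentiable one_ne_zero t).derivWithin (uniqueDiffOn_Icc hab t ht)
    simp only [h2, hcG t (hsub ht)]
  -- The upper bounds on `[0, t]` and `[t, 1]` add up to the total increase `√(ρ x)`, so both are
  -- equalities.
  have h1 := key 0 t (left_mem_Icc.2 zero_le_one) ht ht.1
  have h2 := key t 1 ht (right_mem_Icc.2 zero_le_one) ht.2
  rw [hc0, h.apply_base, Real.sqrt_zero] at h1
  rw [hc1] at h2
  linarith

/-- A radial conformal change of the metric reparametrises the distance to the base point. -/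
theorem isDistanceFunction_conformal (h : IsSquaredDistance G x₀ ρ U) (hG : ContinuousOn G U)
    {a : ℝ → ℝ} {δ : ℝ} (hδ : 0 < δ) (ha : ContinuousOn a (Ioo (-δ) δ))
    (hpos : ∀ s ∈ Ioo (-δ) δ, 0 < a s) {G' : E → E →L[ℝ] E →L[ℝ] ℝ}
    (hG' : ∀ᶠ x in 𝓝 x₀, G' x = a √(ρ x) ^ 2 • G x) :
    ∃ V ⊆ U, IsDistanceFunction G' x₀ (fun x ↦ ∫ s in (0 : ℝ)..√(ρ x), a s) V := by
  obtain ⟨O, hO, hOo, hxO⟩ := eventually_nhds_iff.1 hG'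
  have hVo : IsOpen (U ∩ ((fun x ↦ √(ρ x)) ⁻¹' Iio δ)) :=
    h.continuousOn_sqrt.isOpen_inter_preimage h.isOpen isOpen_Iio
  -- `V` keeps `√ρ` where `a` is controlled and stays where the conformal relation between `G'` and
  -- `G` holds.
  set V := (U ∩ ((fun x ↦ √(ρ x)) ⁻¹' Iio δ)) ∩ O with hV
  have hVU : V ⊆ U := fun x hx ↦ hx.1.1
  have hVopen : IsOpen V := hVo.inter hOo
  have hxV : x₀ ∈ V := ⟨⟨h.mem, by simpa [h.apply_base] using hδ⟩, hxO⟩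
  have hVδ : ∀ x ∈ V, √(ρ x) ∈ Ioo (-δ) δ := fun x hx ↦
    ⟨(neg_neg_of_pos hδ).trans_le (Real.sqrt_nonneg _), hx.1.2⟩
  have h0δ : (0 : ℝ) ∈ Ioo (-δ) δ := ⟨neg_neg_of_pos hδ, hδ⟩
  have hsV := h.continuousOn_sqrt.mono hVU
  have hH := fun r hr ↦
    hasDerivAt_primitive_of_continuousOn isOpen_Ioo ordConnected_Ioo ha h0δ (r := r) hr
  have hwd : ∀ x ∈ V, x ≠ x₀ → HasFDerivAt (fun x ↦ ∫ s in (0 : ℝ)..√(ρ x), a s)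
      (a √(ρ x) • ((1 / (2 * √(ρ x))) • fderiv ℝ ρ x)) x := fun x hx hne ↦
    HasDerivAt.comp_hasFDerivAt (h₂ := fun r ↦ ∫ s in (0 : ℝ)..r, a s) x (hH _ (hVδ x hx))
      (h.hasFDerivAt_sqrt (hVU hx) hne)
  refine ⟨V, hVU, hVopen, hxV, ?_, ?_, ?_, ?_, ?_, ?_, ?_⟩
  · refine ContinuousOn.congr (f := fun x ↦ a √(ρ x) ^ 2 • G x) ?_ fun x hx ↦ hO x hx.2
    exact ((ha.comp hsV hVδ).pow 2).smul (hG.mono hVU)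
  · refine ContinuousOn.comp (g := fun r ↦ ∫ s in (0 : ℝ)..r, a s) (t := Ioo (-δ) δ) ?_ hsV hVδ
    exact fun r hr ↦ (hH r hr).continuousAt.continuousWithinAt
  · simp [h.apply_base]
  · intro x hx hne
    have := strictMonoOn_primitive isOpen_Ioo ordConnected_Ioo ha hpos h0δ h0δ (hVδ x hx)
      (Real.sqrt_pos.2 (h.pos x (hVU hx) hne))
    simpa using this
  · exact fun x hx hne ↦ (hwd x hx hne).differentiableAt
  · intro x hx hne v
    have hax := hpos _ (hVδ x hx)
    rw [(hwd x hx hne).fderiv, hO x hx.2]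
    change a √(ρ x) * ((1 / (2 * √(ρ x))) * fderiv ℝ ρ x v) ≤ √(a √(ρ x) ^ 2 * G x v v)
    rw [Real.sqrt_mul (sq_nonneg _), Real.sqrt_sq hax.le]
    exact mul_le_mul_of_nonneg_left (h.fderiv_sqrt_apply_le (hVU hx) hne v) hax.le
  · filter_upwards [h.geodesic V (hVopen.mem_nhds hxV)] with x hx
    obtain ⟨c, hc, hc0, hc1, hcV⟩ := hx
    refine ⟨c, hc, hc0, hc1, fun t ht ↦ (hcV t ht).1, ?_⟩
    -- The geodesic for `G` also attains the new distance: its `G`-speed is `√(ρ x)` and its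
    -- distance at time `t` is `t * √(ρ x)`, so substituting `s = t * √(ρ x)` turns its `G'`-length
    -- into the primitive of `a`.
    have hint : ∀ t ∈ uIcc (0 : ℝ) 1, √(G' (c t) (deriv c t) (deriv c t)) =
        √(ρ x) * a (t * √(ρ x)) := by
      intro t ht
      rw [uIcc_of_le zero_le_one] at ht
      have hax := hpos _ (hVδ _ (hcV t ht).1)
      rw [hO _ (hcV t ht).1.2]
      change √(a √(ρ (c t)) ^ 2 * G (c t) (deriv c t) (deriv c t)) = _
      rw [(hcV t ht).2, Real.sqrt_mul (sq_nonneg _), Real.sqrt_sq hax.le,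
        h.sqrt_apply_geodesic hG hc hc0 hc1 (fun t ht ↦ hVU (hcV t ht).1)
          (fun t ht ↦ (hcV t ht).2) ht, mul_comm]
    rw [integral_congr hint, intervalIntegral.integral_const_mul,
      mul_integral_comp_mul_right]
    simp

theorem isDistanceFunction (h : IsSquaredDistance G x₀ ρ U) (hG : ContinuousOn G U) :
    ∃ V ⊆ U, IsDistanceFunction G x₀ (fun x ↦ √(ρ x)) V := by
  obtain ⟨V, hVU, hV⟩ := h.isDistanceFunction_conformal hG (a := fun _ ↦ 1) one_pos
    continuousOn_const (fun _ _ ↦ one_pos) (G' := G) (Eventually.of_forall fun x ↦ by simp)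
  exact ⟨V, hVU, by simpa using hV⟩

end IsSquaredDistance

end ConformalDistance

/-! ### The Laplacian under conformal change -/

section Laplacian

variable {m : ℕ} {M : Type*} [TopologicalSpace M] [ChartedSpace (EuclideanSpace ℝ (Fin m)) M]

lemma matrix_inv_smul_of_ne_zero {n : Type*} [Fintype n] [DecidableEq n] (A : Matrix n n ℝ)
    {c : ℝ} (hc : c ≠ 0) : (c • A)⁻¹ = c⁻¹ • A⁻¹ := by
  by_cases hA : IsUnit A.det
  · exact A.inv_smul' (Units.mk0 c hc) hA
  · have h1 : ¬ IsUnit (c • A).det := by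
      rw [Matrix.det_smul, isUnit_iff_ne_zero]
      rw [isUnit_iff_ne_zero, not_not] at hA
      simp [hA]
    rw [Matrix.nonsing_inv_apply_not_isUnit _ hA, Matrix.nonsing_inv_apply_not_isUnit _ h1,
      smul_zero]

/-- The Laplacian of a conformally changed metric, on a function whose differential is rescaled
accordingly. -/
lemma laplaceBeltrami_conformal {g g' : BilinField m M} {P Q : M} {u u' : M → ℝ}
    {α : EuclideanSpace ℝ (Fin m) → ℝ} (hm : 2 ≤ m)
    (hα : ∀ᶠ y in 𝓝 (extChartAt (𝓡 m) P Q), 0 < α y ∧ gram g' P y = α y ^ 2 • gram g P y ∧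
      ∀ j, partialDeriv j (u' ∘ (extChartAt (𝓡 m) P).symm) y =
        (α y)⁻¹ ^ (m - 2) * partialDeriv j (u ∘ (extChartAt (𝓡 m) P).symm) y) :
    laplaceBeltrami g' P u' Q =
      (α (extChartAt (𝓡 m) P Q) ^ m)⁻¹ * laplaceBeltrami g P u Q := by
  have hdet : ∀ y, 0 < α y → gram g' P y = α y ^ 2 • gram g P y →
      √(gram g' P y).det = α y ^ m * √(gram g P y).det := by
    intro y hy h
    rw [h, Matrix.det_smul, Fintype.card_fin, ← pow_mul, mul_comm 2 m, pow_mul,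
      Real.sqrt_mul (sq_nonneg _), Real.sqrt_sq (by positivity)]
  have hinner : ∀ i : Fin m, (fun y ↦ √(gram g' P y).det * ∑ j : Fin m, (gram g' P y)⁻¹ i j *
      partialDeriv j (u' ∘ (extChartAt (𝓡 m) P).symm) y) =ᶠ[𝓝 (extChartAt (𝓡 m) P Q)]
      (fun y ↦ √(gram g P y).det * ∑ j : Fin m, (gram g P y)⁻¹ i j *
      partialDeriv j (u ∘ (extChartAt (𝓡 m) P).symm) y) := by
    intro i
    filter_upwards [hα] with y hy
    obtain ⟨hpos, hgram, hu⟩ := hy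
    rw [hdet y hpos hgram, Finset.mul_sum, Finset.mul_sum]
    refine Finset.sum_congr rfl fun j _ ↦ ?_
    rw [hu j, hgram, matrix_inv_smul_of_ne_zero _ (by positivity), Matrix.smul_apply, smul_eq_mul]
    -- Writing `m = 2 + k` removes the truncated subtraction. The factors `α^m` from the volume,
    -- `α^(-2)` from the inverse metric and `α^(-(m-2))` from the differential then cancel.
    obtain ⟨k, rfl⟩ := Nat.exists_eq_add_of_le hm
    have : α y ^ (2 + k) * ((α y ^ 2)⁻¹ * (α y)⁻¹ ^ (2 + k - 2)) = 1 := by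
      rw [Nat.add_sub_cancel_left, inv_pow]
      field_simp
      ring
    linear_combination (√(gram g P y).det * (gram g P y)⁻¹ i j *
      partialDeriv j (u ∘ (extChartAt (𝓡 (2 + k)) P).symm) y) * this
  obtain ⟨hpos, hgram, -⟩ := hα.self_of_nhds
  simp only [laplaceBeltrami]
  rw [hdet _ hpos hgram, mul_inv]
  have hsum := Finset.sum_congr rfl fun i (_ : i ∈ Finset.univ) ↦
    congrArg (fun L : EuclideanSpace ℝ (Fin m) →L[ℝ] ℝ ↦ L (EuclideanSpace.single i 1))
      (hinner i).fderiv_eq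
  simp only [partialDeriv] at hsum ⊢
  rw [hsum]
  ring

lemma coordMetric_radialConformal (g : BilinField m M) (P : M) (ψ : ℝ → ℝ)
    (y : EuclideanSpace ℝ (Fin m)) :
    coordMetric (radialConformal g P ψ) P y =
      (ψ (geodesicDist g P ((extChartAt (𝓡 m) P).symm y) ^ 2) ^ 2)⁻¹ • coordMetric g P y := rfl

lemma partialDeriv_radial {F : ℝ → ℝ} {r : EuclideanSpace ℝ (Fin m) → ℝ} {u : M → ℝ} {P : M}
    {y : EuclideanSpace ℝ (Fin m)} {F' : ℝ} (hF : HasDerivAt F F' (r y))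
    (hr : DifferentiableAt ℝ r y)
    (hu : u ∘ (extChartAt (𝓡 m) P).symm =ᶠ[𝓝 y] fun z ↦ F (r z)) (j : Fin m) :
    partialDeriv j (u ∘ (extChartAt (𝓡 m) P).symm) y = F' * partialDeriv j r y := by
  have h1 := hF.comp_hasFDerivAt y hr.hasFDerivAt
  simp only [partialDeriv]
  rw [hu.fderiv_eq, show fderiv ℝ (fun z ↦ F (r z)) y = _ from h1.fderiv]
  rfl

end Laplacian

/-! ### Non-constancy of the new radial solution -/

section RadialSolution

/-- If `b > 0`, the antiderivative of `b f'` is not constant unless `f` is. -/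
lemma exists_ne_primitive_mul_deriv {f b : ℝ → ℝ} {I : Set ℝ} (hI : IsOpen I)
    (hc : I.OrdConnected) (hf : ContDiffOn ℝ ∞ f I) (hb : ContinuousOn b I)
    (hb0 : ∀ s ∈ I, b s ≠ 0) {r₀ : ℝ} (hr₀ : r₀ ∈ I) (hne : ∃ s ∈ I, ∃ t ∈ I, f s ≠ f t) :
    ∃ s ∈ I, ∃ t ∈ I,
      (∫ x in r₀..s, b x * deriv f x) ≠ ∫ x in r₀..t, b x * deriv f x := by
  obtain ⟨s, hs, t, ht, hst⟩ := hne
  by_contra! hcon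
  apply hst
  have hcont : ContinuousOn (fun x ↦ b x * deriv f x) I :=
    hb.mul (hf.continuousOn_deriv_of_isOpen hI (by simp))
  refine hI.is_const_of_deriv_eq_zero hc.isPreconnected (hf.differentiableOn (by simp)) ?_ hs ht
  intro x hx
  have h1 := hasDerivAt_primitive_of_continuousOn hI hc hcont hr₀ hx
  have h2 : (fun r ↦ ∫ x in r₀..r, b x * deriv f x) =ᶠ[𝓝 x]
      fun _ ↦ ∫ x in r₀..r₀, b x * deriv f x := by
    filter_upwards [hI.mem_nhds hx] with r hr using hcon r hr r₀ hr₀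
  have h3 := h1.unique ((hasDerivAt_const x _).congr_of_eventuallyEq h2)
  exact (mul_eq_zero.1 h3).resolve_left (hb0 x hx)

end RadialSolution

/-! ### The conformal weight and the inverse of its primitive -/

section RadialWeight

/-- The conformal weight `|ψ (s²)|⁻¹` is smooth and positive near `0`. -/
lemma exists_contDiffOn_weight {ψ : ℝ → ℝ} (hψ : ∀ᶠ t in 𝓝 (0 : ℝ), ContDiffAt ℝ ∞ ψ t)
    (hψ0 : ψ 0 ≠ 0) :
    ∃ δ > 0, ContDiffOn ℝ ∞ (fun s ↦ |ψ (s ^ 2)|⁻¹) (Ioo (-δ) δ) ∧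
      ∀ s ∈ Ioo (-δ) δ, 0 < |ψ (s ^ 2)|⁻¹ := by
  have h1 : ∀ᶠ t in 𝓝 (0 : ℝ), ContDiffAt ℝ ∞ ψ t ∧ ψ t ≠ 0 :=
    hψ.and (hψ.self_of_nhds.continuousAt.eventually_ne hψ0)
  have hsq : Tendsto (fun s : ℝ ↦ s ^ 2) (𝓝 0) (𝓝 0) := by
    have := (continuous_pow 2).tendsto (0 : ℝ)
    simpa using this
  obtain ⟨δ, hδ, h⟩ := Metric.eventually_nhds_iff_ball.1 (hsq.eventually h1)
  rw [Real.ball_eq_Ioo, zero_sub, zero_add] at h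
  refine ⟨δ, hδ, fun s hs ↦ ContDiffAt.contDiffWithinAt ?_, fun s hs ↦
    inv_pos.2 (abs_pos.2 (h s hs).2)⟩
  have h2 : ContDiffAt ℝ ∞ (fun s ↦ ψ (s ^ 2)) s :=
    ContDiffAt.comp (f := fun s ↦ s ^ 2) s (h s hs).1 (contDiff_id.pow 2).contDiffAt
  have h3 : ContDiffAt ℝ ∞ (fun s ↦ |ψ (s ^ 2)|) s :=
    ContDiffAt.comp (g := fun x : ℝ ↦ |x|) s (contDiffAt_abs (h s hs).2) h2
  exact h3.inv (abs_ne_zero.2 (h s hs).2)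

/-- A primitive of a positive smooth function has a smooth inverse near `0`. -/
lemma exists_inverse_primitive {a : ℝ → ℝ} {δ : ℝ} (hδ : 0 < δ)
    (ha : ContDiffOn ℝ ∞ a (Ioo (-δ) δ)) (hpos : ∀ s ∈ Ioo (-δ) δ, 0 < a s) :
    ∃ (k : ℝ → ℝ) (η : ℝ), 0 < η ∧ ContDiffOn ℝ ∞ k (Ioo (-η) η) ∧ Tendsto k (𝓝 0) (𝓝 0) ∧
      ∀ s ∈ Ioo (-η) η, k s ∈ Ioo (-δ) δ ∧ ∫ x in (0 : ℝ)..k s, a x = s := by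
  have h0 : (0 : ℝ) ∈ Ioo (-δ) δ := ⟨neg_neg_of_pos hδ, hδ⟩
  have hd := hasDerivAt_primitive_of_continuousOn isOpen_Ioo ordConnected_Ioo ha.continuousOn h0 h0
  obtain ⟨e, he0, hes, hef, hesm⟩ := exists_openPartialHomeomorph_contDiffOn isOpen_Ioo h0
    (contDiffOn_primitive isOpen_Ioo ordConnected_Ioo ha h0)
    (hd.hasFDerivAt_equiv (hpos 0 h0).ne')
  have he00 : e 0 = 0 := by rw [hef, intervalIntegral.integral_same]
  have h0t : (0 : ℝ) ∈ e.target := by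
    have := e.map_source he0
    rwa [he00] at this
  obtain ⟨η, hη, hηt⟩ := Metric.isOpen_iff.1 e.open_target 0 h0t
  rw [Real.ball_eq_Ioo, zero_sub, zero_add] at hηt
  refine ⟨e.symm, η, hη, hesm.mono hηt, ?_, fun s hs ↦ ⟨hes (e.map_target (hηt hs)), ?_⟩⟩
  · have h1 := e.continuousAt_symm h0t
    have h2 : e.symm 0 = 0 := by
      conv_lhs => rw [← he00]
      exact e.left_inv he0
    rwa [ContinuousAt, h2] at h1
  · rw [← hef]
    exact e.right_inv (hηt hs)

end RadialWeight

/-! ### Transfer of central harmonicity -/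

section Transfer

variable {m : ℕ} {M : Type*} [TopologicalSpace M] [ChartedSpace (EuclideanSpace ℝ (Fin m)) M]
  [IsManifold (𝓡 m) ∞ M]

/-- A smooth radial function in coordinates is smooth on the manifold. -/
lemma contMDiffAt_comp_extChartAt {P Q : M} (hQ : Q ∈ (extChartAt (𝓡 m) P).source)
    {f : EuclideanSpace ℝ (Fin m) → ℝ} (hf : ContDiffAt ℝ ∞ f (extChartAt (𝓡 m) P Q)) :
    ContMDiffAt (𝓡 m) 𝓘(ℝ, ℝ) ∞ (fun x ↦ f (extChartAt (𝓡 m) P x)) Q :=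
  hf.contMDiffAt.comp Q (contMDiffAt_extChartAt' (by rwa [extChartAt_source] at hQ))

/-- The factor depends on the distance only through its square, which is the smooth function `ρ` in
the chart, so there is no loss of smoothness at `P`. -/
lemma isRiemannianNear_radialConformal {g : BilinField m M} {P : M} (hg : IsRiemannianNear g P)
    {ψ : ℝ → ℝ} (hψ : ∀ᶠ t in 𝓝 (0 : ℝ), ContDiffAt ℝ ∞ ψ t) (hψ0 : ψ 0 ≠ 0)
    {ρ : EuclideanSpace ℝ (Fin m) → ℝ} {U : Set (EuclideanSpace ℝ (Fin m))} (hU : IsOpen U)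
    (hPU : extChartAt (𝓡 m) P P ∈ U) (hρ : ContDiffOn ℝ ∞ ρ U)
    (hρ0 : ρ (extChartAt (𝓡 m) P P) = 0)
    (hdist : ∀ᶠ Q in 𝓝 P, geodesicDist g P Q ^ 2 = ρ (extChartAt (𝓡 m) P Q)) :
    IsRiemannianNear (radialConformal g P ψ) P := by
  have h1 : ∀ᶠ t in 𝓝 (0 : ℝ), ContDiffAt ℝ ∞ ψ t ∧ ψ t ≠ 0 :=
    hψ.and (hψ.self_of_nhds.continuousAt.eventually_ne hψ0)
  have hρc : Tendsto ρ (𝓝 (extChartAt (𝓡 m) P P)) (𝓝 0) := by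
    have := hρ.continuousOn.continuousAt (hU.mem_nhds hPU)
    rwa [ContinuousAt, hρ0] at this
  have hφ := continuousAt_extChartAt (I := 𝓡 m) P
  filter_upwards [hg, hdist.eventually_nhds, hφ.eventually (hρc.eventually h1),
    hφ.eventually (hU.mem_nhds hPU), extChartAt_source_mem_nhds (I := 𝓡 m) P]
    with Q hgQ hdQ hψQ hQU hQs
  have hQ : geodesicDist g P Q ^ 2 = ρ (extChartAt (𝓡 m) P Q) := hdQ.self_of_nhds
  have hpos : 0 < (ψ (geodesicDist g P Q ^ 2) ^ 2)⁻¹ := by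
    rw [hQ]
    have := hψQ.2
    positivity
  refine ⟨fun v w ↦ ?_, fun v hv ↦ ?_, ?_⟩
  · exact congrArg (fun x ↦ (ψ (geodesicDist g P Q ^ 2) ^ 2)⁻¹ * x) (hgQ.1 v w)
  · exact mul_pos hpos (hgQ.2.1 v hv)
  · have hs : ContMDiffAt (𝓡 m) 𝓘(ℝ, ℝ) ∞ (fun x ↦ (ψ (geodesicDist g P x ^ 2) ^ 2)⁻¹) Q := by
      have h2 : ContDiffAt ℝ ∞ (fun y ↦ (ψ (ρ y) ^ 2)⁻¹) (extChartAt (𝓡 m) P Q) :=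
        ((hψQ.1.comp _ (hρ.contDiffAt (hU.mem_nhds hQU))).pow 2).inv (pow_ne_zero 2 hψQ.2)
      refine (contMDiffAt_comp_extChartAt hQs h2).congr_of_eventuallyEq ?_
      filter_upwards [hdQ] with x hx
      rw [hx]
    exact hs.smul_section hgQ.2.2

/-- Existence of radial harmonic functions is inherited by a radial conformal change of the metric,
on a punctured ball on which both distances are given in coordinates by `r` and by a primitive `h`
of the conformal factor. -/
lemma hasRadialHarmonic_of_conformal (hm : 2 ≤ m) {g g' : BilinField m M} {P : M}
    {r : EuclideanSpace ℝ (Fin m) → ℝ} {h k a : ℝ → ℝ} {ε ε' : ℝ} (hε : 0 < ε)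
    (hh : ∀ s ∈ Ioo 0 ε, h s ∈ Ioo 0 ε' ∧ k (h s) = s)
    (hk : ∀ s ∈ Ioo 0 ε', k s ∈ Ioo 0 ε)
    (hks : ContDiffOn ℝ ∞ k (Ioo 0 ε')) (ha : ContDiffOn ℝ ∞ a (Ioo 0 ε))
    (hpos : ∀ s ∈ Ioo 0 ε, 0 < a s)
    (hloc : ∀ Q : M, 0 < geodesicDist g' P Q → geodesicDist g' P Q < ε' →
      Q ∈ (extChartAt (𝓡 m) P).source ∧ ContDiffAt ℝ ∞ r (extChartAt (𝓡 m) P Q) ∧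
      r (extChartAt (𝓡 m) P Q) ∈ Ioo 0 ε ∧
      ∀ᶠ x in 𝓝 Q, geodesicDist g P x = r (extChartAt (𝓡 m) P x) ∧
        geodesicDist g' P x = h (r (extChartAt (𝓡 m) P x)) ∧
        coordMetric g' P (extChartAt (𝓡 m) P x) =
          a (r (extChartAt (𝓡 m) P x)) ^ 2 • coordMetric g P (extChartAt (𝓡 m) P x))
    (hg : HasRadialHarmonic g P ε) : HasRadialHarmonic g' P ε' := by
  obtain ⟨f, hf, hfne, hfh⟩ := hg
  -- The weight `b` is the factor by which the differential must be rescaled in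
  -- `laplaceBeltrami_conformal`. The new solution is `F` with `F' = b f'`, read as a function of
  -- the new distance through `k`.
  let b : ℝ → ℝ := fun s ↦ (a s)⁻¹ ^ (m - 2)
  have hb : ContDiffOn ℝ ∞ b (Ioo 0 ε) := (ha.inv fun s hs ↦ (hpos s hs).ne').pow _
  have hb0 : ∀ s ∈ Ioo 0 ε, b s ≠ 0 := fun s hs ↦ pow_ne_zero _ (inv_ne_zero (hpos s hs).ne')
  have hf' : ContDiffOn ℝ ∞ (deriv f) (Ioo 0 ε) :=
    ((contDiffOn_infty_iff_deriv_of_isOpen isOpen_Ioo).1 hf).2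
  -- The base point of the primitive is interior because `f` may be singular at `0`.
  have hr₀ : ε / 2 ∈ Ioo 0 ε := ⟨by linarith, by linarith⟩
  let F : ℝ → ℝ := fun s ↦ ∫ x in (ε / 2)..s, b x * deriv f x
  have hF : ContDiffOn ℝ ∞ F (Ioo 0 ε) :=
    contDiffOn_primitive isOpen_Ioo ordConnected_Ioo (hb.mul hf') hr₀
  have hFd : ∀ s ∈ Ioo 0 ε, HasDerivAt F (b s * deriv f s) s := fun s hs ↦
    hasDerivAt_primitive_of_continuousOn isOpen_Ioo ordConnected_Ioo (hb.mul hf').continuousOn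
      hr₀ hs
  refine ⟨F ∘ k, hF.comp hks hk, ?_, ?_⟩
  · obtain ⟨s, hs, t, ht, hst⟩ := exists_ne_primitive_mul_deriv isOpen_Ioo ordConnected_Ioo hf
      hb.continuousOn hb0 hr₀ hfne
    refine ⟨h s, (hh s hs).1, h t, (hh t ht).1, ?_⟩
    simp only [Function.comp_apply, (hh s hs).2, (hh t ht).2]
    exact hst
  · intro Q hQ0 hQε
    obtain ⟨hQs, hrs, hrQ, hev⟩ := hloc Q hQ0 hQε
    have hrcont : ContinuousAt (fun x ↦ r (extChartAt (𝓡 m) P x)) Q :=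
      ContinuousAt.comp hrs.continuousAt (continuousAt_extChartAt' hQs)
    have hrI : ∀ᶠ x in 𝓝 Q, r (extChartAt (𝓡 m) P x) ∈ Ioo 0 ε :=
      hrcont.eventually (isOpen_Ioo.mem_nhds hrQ)
    have hFk : ∀ᶠ x in 𝓝 Q, (F ∘ k) (geodesicDist g' P x) = F (r (extChartAt (𝓡 m) P x)) := by
      filter_upwards [hev, hrI] with x hx hxI
      rw [hx.2.1, Function.comp_apply, (hh _ hxI).2]
    have hgQ : geodesicDist g P Q = r (extChartAt (𝓡 m) P Q) := hev.self_of_nhds.1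
    refine ⟨?_, ?_⟩
    · have h2 : ContDiffAt ℝ ∞ (fun y ↦ F (r y)) (extChartAt (𝓡 m) P Q) :=
        (hF.contDiffAt (isOpen_Ioo.mem_nhds hrQ)).comp _ hrs
      exact (contMDiffAt_comp_extChartAt hQs h2).congr_of_eventuallyEq hFk
    · have hharm := (hfh Q (by rw [hgQ]; exact hrQ.1) (by rw [hgQ]; exact hrQ.2)).2
      -- transport neighbourhoods of `Q` to the chart
      have hback : ∀ {p : M → Prop}, (∀ᶠ x in 𝓝 Q, p x) →
          ∀ᶠ y in 𝓝 (extChartAt (𝓡 m) P Q), p ((extChartAt (𝓡 m) P).symm y) := by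
        intro p hp
        have hc := continuousAt_extChartAt_symm' (I := 𝓡 m) hQs
        rw [ContinuousAt, (extChartAt (𝓡 m) P).left_inv hQs] at hc
        exact hc.eventually hp
      have htgt : ∀ᶠ y in 𝓝 (extChartAt (𝓡 m) P Q), y ∈ (extChartAt (𝓡 m) P).target :=
        (isOpen_extChartAt_target P).mem_nhds ((extChartAt (𝓡 m) P).map_source hQs)
      have hrd : ∀ᶠ y in 𝓝 (extChartAt (𝓡 m) P Q), DifferentiableAt ℝ r y := by
        have h1 : ContDiffAt ℝ 1 r (extChartAt (𝓡 m) P Q) := hrs.of_le (by simp)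
        filter_upwards [h1.eventually (by simp)] with y hy using hy.differentiableAt one_ne_zero
      have hlap := laplaceBeltrami_conformal (g := g) (g' := g') (P := P) (Q := Q)
        (u := fun x ↦ f (geodesicDist g P x)) (u' := fun x ↦ (F ∘ k) (geodesicDist g' P x))
        (α := fun y ↦ a (r y)) hm ?_
      · rw [hlap, hharm, mul_zero]
      have hev1 := hback hev
      have hev2 := hback hFk
      have hev3 := hback hrI
      -- Comparing partial derivatives at `y` requires the radial formulas on a neighbourhood of
      -- `y`, hence `eventually_nhds`.
      filter_upwards [htgt.eventually_nhds, hrd, hev1.eventually_nhds, hev2.eventually_nhds,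
        hev3] with y hyt hyd hy1 hy2 hy3
      have hinv : extChartAt (𝓡 m) P ((extChartAt (𝓡 m) P).symm y) = y :=
        (extChartAt (𝓡 m) P).right_inv hyt.self_of_nhds
      rw [hinv] at hy3
      refine ⟨hpos _ hy3, ?_, fun j ↦ ?_⟩
      · have := hy1.self_of_nhds.2.2
        rw [hinv] at this
        ext i j
        rw [Matrix.smul_apply, gram_apply, gram_apply, this]
        rfl
      · have hu' : (fun x ↦ (F ∘ k) (geodesicDist g' P x)) ∘ (extChartAt (𝓡 m) P).symm =ᶠ[𝓝 y]
            fun z ↦ F (r z) := by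
          filter_upwards [hy2, hyt] with z hz hzt
          rw [(extChartAt (𝓡 m) P).right_inv hzt] at hz
          exact hz
        have hu : (fun x ↦ f (geodesicDist g P x)) ∘ (extChartAt (𝓡 m) P).symm =ᶠ[𝓝 y]
            fun z ↦ f (r z) := by
          filter_upwards [hy1, hyt] with z hz hzt
          have := hz.1
          rw [(extChartAt (𝓡 m) P).right_inv hzt] at this
          exact congrArg f this
        have hfd : HasDerivAt f (deriv f (r y)) (r y) :=
          ((hf.contDiffAt (isOpen_Ioo.mem_nhds hy3)).differentiableAt (by simp)).hasDerivAt
        rw [partialDeriv_radial (hFd _ hy3) hyd hu', partialDeriv_radial hfd hyd hu, mul_assoc]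

/-- Central harmonicity is inherited by radial conformal deformations. -/
theorem isCentrallyHarmonic_radialConformal [T2Space M] (hm : 2 ≤ m)
    {g : BilinField m M} {P : M}
    (hg : IsRiemannianNear g P)
    {ψ : ℝ → ℝ} (hψ : ∀ᶠ t in 𝓝 (0 : ℝ), ContDiffAt ℝ ∞ ψ t) (hψ0 : ψ 0 ≠ 0)
    (hP : IsCentrallyHarmonic g P) :
    IsRiemannianNear (radialConformal g P ψ) P ∧
      IsCentrallyHarmonic (radialConformal g P ψ) P := by
  obtain ⟨U₀, hU₀, hPU₀, hU₀t, hG, hGs, hGp⟩ := exists_contDiffOn_coordMetric hg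
  obtain ⟨ρ, U, hUU₀, hρ⟩ := exists_isSquaredDistance hU₀ hPU₀ hG hGs hGp
  have hGU : ContinuousOn (coordMetric g P) U := hG.continuousOn.mono hUU₀
  have hUt : U ⊆ (extChartAt (𝓡 m) P).target := hUU₀.trans hU₀t
  have hφ := continuousAt_extChartAt (I := 𝓡 m) P
  have hρnn : ∀ y ∈ U, 0 ≤ ρ y := by
    intro y hy
    rcases eq_or_ne y (extChartAt (𝓡 m) P P) with rfl | hne
    · exact hρ.apply_base.ge
    · exact (hρ.pos y hy hne).le
  obtain ⟨V, hVU, hV⟩ := hρ.isDistanceFunction hGU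
  have hdist : ∀ᶠ Q in 𝓝 P, geodesicDist g P Q = √(ρ (extChartAt (𝓡 m) P Q)) :=
    hV.eventually_geodesicDist_eq (hVU.trans hUt)
  have hUev : ∀ᶠ Q in 𝓝 P, extChartAt (𝓡 m) P Q ∈ U :=
    hφ.eventually (hρ.isOpen.mem_nhds hρ.mem)
  refine ⟨isRiemannianNear_radialConformal hg hψ hψ0 hρ.isOpen hρ.mem hρ.contDiffOn hρ.apply_base
    (by
      filter_upwards [hdist, hUev] with Q hQ hQU
      rw [hQ, Real.sq_sqrt (hρnn _ hQU)]), ?_⟩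
  obtain ⟨δ, hδ, ha, hpos⟩ := exists_contDiffOn_weight hψ hψ0
  set a : ℝ → ℝ := fun s ↦ |ψ (s ^ 2)|⁻¹ with ha_def
  have h0δ : (0 : ℝ) ∈ Ioo (-δ) δ := ⟨neg_neg_of_pos hδ, hδ⟩
  -- the conformal metric in coordinates
  have hG' : ∀ᶠ y in 𝓝 (extChartAt (𝓡 m) P P),
      coordMetric (radialConformal g P ψ) P y = a √(ρ y) ^ 2 • coordMetric g P y := by
    have hc := continuousAt_extChartAt_symm (I := 𝓡 m) P
    rw [ContinuousAt, extChartAt_to_inv] at hc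
    filter_upwards [hc.eventually hdist, (isOpen_extChartAt_target P).mem_nhds
      (mem_extChartAt_target (I := 𝓡 m) P)] with y hy hyt
    rw [coordMetric_radialConformal, hy, (extChartAt (𝓡 m) P).right_inv hyt, ha_def]
    simp only [inv_pow, sq_abs]
  obtain ⟨V', hV'U, hV'⟩ := hρ.isDistanceFunction_conformal hGU hδ ha.continuousOn hpos hG'
  have hdist' := hV'.eventually_geodesicDist_eq (hV'U.trans hUt)
  obtain ⟨k, η, hη, hks, hk0, hk⟩ := exists_inverse_primitive hδ ha hpos
  set h : ℝ → ℝ := fun r ↦ ∫ s in (0 : ℝ)..r, a s with hh_def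
  have hmono : StrictMonoOn h (Ioo (-δ) δ) :=
    strictMonoOn_primitive isOpen_Ioo ordConnected_Ioo ha.continuousOn hpos h0δ
  have hh0 : h 0 = 0 := intervalIntegral.integral_same
  have hδev : ∀ᶠ Q in 𝓝 P, √(ρ (extChartAt (𝓡 m) P Q)) ∈ Ioo (-δ) δ := by
    have h1 : ContinuousAt (fun y ↦ √(ρ y)) (extChartAt (𝓡 m) P P) :=
      hρ.continuousOn_sqrt.continuousAt (hρ.isOpen.mem_nhds hρ.mem)
    refine hφ.eventually (h1.eventually (isOpen_Ioo.mem_nhds ?_))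
    simp only [hρ.apply_base, Real.sqrt_zero]
    exact h0δ
  -- Every point of `M` at positive new distance less than `ε₁` lies close to `P`, and both distance
  -- formulas and the conformal relation hold on a neighbourhood of it.
  obtain ⟨ε₁, hε₁, hloc⟩ := hV'.exists_mem_of_geodesicDist_lt (hV'U.trans hUt)
    ((((hdist.and hdist').and (hφ.eventually hG')).eventually_nhds.and
      (hUev.and hδev)).and (extChartAt_source_mem_nhds (I := 𝓡 m) P))
  have hkpos : ∀ s ∈ Ioo 0 η, 0 < k s := by
    intro s hs
    have hs' := hk s ⟨(neg_neg_of_pos hη).trans hs.1, hs.2⟩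
    rw [← hmono.lt_iff_lt h0δ hs'.1, hh0]
    exact hs.1.trans_eq hs'.2.symm
  have hη' : ∀ᶠ s in 𝓝[>] (0 : ℝ), s ∈ Ioo 0 η := Ioo_mem_nhdsGT hη
  have hkt : Tendsto k (𝓝[>] 0) (𝓝[>] 0) :=
    tendsto_nhdsWithin_iff.2 ⟨hk0.mono_left nhdsWithin_le_nhds, hη'.mono hkpos⟩
  -- The new ball of radius `ε'` corresponds to the old ball of radius `k ε'`. As `k` tends to `0`
  -- from the right, the hypothesis applies to that radius for all small `ε'`.
  filter_upwards [hkt.eventually hP, hη', Ioo_mem_nhdsGT hε₁] with ε' hharm hε'η hε'₁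
  have hsub : Ioo 0 ε' ⊆ Ioo (-η) η := fun s hs ↦
    ⟨(neg_neg_of_pos hη).trans hs.1, hs.2.trans hε'η.2⟩
  have hkε' := hk ε' ⟨(neg_neg_of_pos hη).trans hε'η.1, hε'η.2⟩
  have hkε'pos := hkpos ε' hε'η
  have hεsub : Ioo 0 (k ε') ⊆ Ioo (-δ) δ := fun s hs ↦
    ⟨(neg_neg_of_pos hδ).trans hs.1, hs.2.trans hkε'.1.2⟩
  have hhk : ∀ s ∈ Ioo (-δ) δ, h s ∈ Ioo 0 ε' ↔ s ∈ Ioo 0 (k ε') := by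
    intro s hs
    have h1 : h (k ε') = ε' := hkε'.2
    constructor
    · rintro ⟨h2, h3⟩
      rw [← hh0, hmono.lt_iff_lt h0δ hs] at h2
      rw [← h1, hmono.lt_iff_lt hs hkε'.1] at h3
      exact ⟨h2, h3⟩
    · rintro ⟨h2, h3⟩
      rw [← hmono.lt_iff_lt h0δ hs, hh0] at h2
      rw [← hmono.lt_iff_lt hs hkε'.1, h1] at h3
      exact ⟨h2, h3⟩
  refine hasRadialHarmonic_of_conformal hm (r := fun y ↦ √(ρ y)) (h := h) (k := k) (a := a)
    hkε'pos ?_ ?_ (hks.mono hsub) (ha.mono hεsub) (fun s hs ↦ hpos s (hεsub hs)) ?_ hharm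
  · intro s hs
    have h1 := (hhk s (hεsub hs)).2 hs
    have h2 := hk _ (hsub h1)
    exact ⟨h1, hmono.injOn h2.1 (hεsub hs) h2.2⟩
  · intro s hs
    have h2 := hk s (hsub hs)
    rw [← hhk _ h2.1]
    rwa [show h (k s) = s from h2.2]
  · intro Q hQ0 hQε
    obtain ⟨⟨hQ, hQU, hQδ⟩, hQs⟩ := hloc Q hQ0 (hQε.trans hε'₁.2)
    have hQ' : geodesicDist (radialConformal g P ψ) P Q = h √(ρ (extChartAt (𝓡 m) P Q)) :=
      hQ.self_of_nhds.1.2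
    have hr : √(ρ (extChartAt (𝓡 m) P Q)) ∈ Ioo 0 (k ε') := by
      rw [← hhk _ hQδ, ← hQ']
      exact ⟨hQ0, hQε⟩
    refine ⟨hQs, ?_, hr, ?_⟩
    · exact (hρ.contDiffOn.contDiffAt (hρ.isOpen.mem_nhds hQU)).sqrt (Real.sqrt_pos.1 hr.1).ne'
    · filter_upwards [hQ] with x hx
      exact ⟨hx.1.1, hx.1.2, hx.2⟩

end Transfer

end CentralHarmonic

theorem theorem1p3 {m : ℕ} (hm : 2 ≤ m) {M : Type*} [TopologicalSpace M] [T2Space M]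
    [ChartedSpace (EuclideanSpace ℝ (Fin m)) M] [IsManifold (𝓡 m) ∞ M]
    (g : CentralHarmonic.BilinField m M) (P : M)
    (hg : CentralHarmonic.IsRiemannianNear g P)
    (ψ : ℝ → ℝ) (hψ : ∀ᶠ t in 𝓝 (0 : ℝ), ContDiffAt ℝ ∞ ψ t) (hψ0 : ψ 0 ≠ 0)
    (hP : CentralHarmonic.IsCentrallyHarmonic g P) :
    CentralHarmonic.IsRiemannianNear (CentralHarmonic.radialConformal g P ψ) P ∧
      CentralHarmonic.IsCentrallyHarmonic (CentralHarmonic.radialConformal g P ψ) P :=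
  CentralHarmonic.isCentrallyHarmonic_radialConformal hm hg hψ hψ0 hP
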